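/- Let $p$ be a prime, $r\ge 1$, $q=p^r$, and let $l$ be a prime with $l\ne 2$ and $l\neq p$. Let $k$ be a field with $\operatorname{char} k\ne l$, and let $d$ be the smallest positive integer such that $l\mid q^d-1$. Let $n\ge 0$, write $\overline{a}=a^q$ for the nontrivial automorphism of $\mathbb F_{q^2}$ over $\mathbb F_q$, let $\beta\in GL_n(\mathbb F_{q^2})$ be an invertible Hermitian matrix (that is, $\beta^T=\overline\beta$), and let $U(n,q^2)=\{M\in GL_n(\mathbb F_{q^2}) : M^T\beta\overline M=\beta\}$ be the corresponding unitary group. For a finite group $G$, a field extension $F/k$ and a $G$-torsor $t$ over $\operatorname{Spec}F$, let $\operatorname{ed}_k(t,l)$ be the minimum of $\operatorname{trdeg}_k(M)$ over all finite field extensions $E/F$ with $l\nmid [E:F]$ and all intermediate fields $k\subseteq M\subseteq E$ such that the base change $t_E$ is isomorphic to the base change to $E$ of some $G$-torsor over $\operatorname{Spec} M$; and let $\operatorname{ed}_k(G,l)$, the essential $l$-dimension of $G$ over $k$, be the supremum of $\operatorname{ed}_k(t,l)$ over all field extensions $F/k$ and all $G$-torsors $t$ over $\operatorname{Spec} F$.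 Then $$\operatorname{ed}_k(U(n,q^2),l)=\begin{cases}\operatorname{ed}_k(GL_n(\mathbb F_{q^2}),l), & d\equiv 2 \pmod 4,\\ \operatorname{ed}_k(GL_{\lfloor n/2\rfloor}(\mathbb F_{q^2}),l), & d\not\equiv 2\pmod 4.\end{cases}$$ -/

import Mathlib

open scoped TensorProduct Matrix

universe u v

noncomputable section

/-! ### Torsors of a finite group over a field, as Galois algebras -/

/-- For an action `ρ` of `G` on a commutative `F`-algebra `L` by `F`-algebra automorphisms, the map
`L ⊗[F] L → ∏_{g ∈ G} L`, `a ⊗ b ↦ (a * g b)_g`. It is dual to the map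
`Spec L × G → Spec L ×_F Spec L`, `(x, g) ↦ (x, x g)`. -/
def galoisMap {G : Type v} {F L : Type u} [Group G] [Field F] [CommRing L] [Algebra F L]
    (ρ : G →* (L ≃ₐ[F] L)) : L ⊗[F] L →ₐ[F] (G → L) :=
  AlgHom.pi fun g =>
    Algebra.TensorProduct.productMap (AlgHom.id F L) (ρ g : L →ₐ[F] L)

/-- A `G`-torsor over `Spec F` for a finite group `G` (a Galois `G`-algebra over `F`): a nonzero
commutative `F`-algebra `L` with an action of `G` by `F`-algebra automorphisms such that
`L ⊗[F] L → ∏_{g ∈ G} L` is bijective. -/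
structure GaloisAlgebra (G : Type v) [Group G] (F : Type u) [Field F] where
  carrier : Type u
  [commRing : CommRing carrier]
  [algebra : Algebra F carrier]
  nontrivial : Nontrivial carrier
  action : G →* (carrier ≃ₐ[F] carrier)
  bijective : Function.Bijective (galoisMap action)

attribute [instance] GaloisAlgebra.commRing GaloisAlgebra.algebra

namespace GaloisAlgebra

variable {G : Type v} [Group G]

/-- The action of `g ∈ G` on the base change `E ⊗[F] L` of a `G`-torsor along `F → E`. -/
def baseAction {F : Type u} [Field F] (t : GaloisAlgebra G F) (E : Type u) [Field E] [Algebra F E]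
    (g : G) : E ⊗[F] t.carrier →ₐ[E] E ⊗[F] t.carrier :=
  Algebra.TensorProduct.map (AlgHom.id E E) (t.action g : t.carrier →ₐ[F] t.carrier)

/-- For field extensions `F → E` and `M → E`, the torsors `t` over `F` and `s` over `M` become
isomorphic (`G`-equivariantly, as `E`-algebras) over `E`, that is, they have the same image
in `H¹(E, G)`. -/
def SameOver {F M : Type u} [Field F] [Field M] (t : GaloisAlgebra G F) (s : GaloisAlgebra G M)
    (E : Type u) [Field E] [Algebra F E] [Algebra M E] : Prop :=
  ∃ e : (E ⊗[M] s.carrier) ≃ₐ[E] (E ⊗[F] t.carrier),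
    ∀ (g : G) (x : E ⊗[M] s.carrier), e (s.baseAction E g x) = t.baseAction E g (e x)

/-- The essential `l`-dimension `ed_k(t, l)` of a `G`-torsor `t` over `F ⊇ k`: the minimum of
`trdeg_k M` over all finite extensions `E / F` of degree prime to `l` and all intermediate fields
`k ⊆ M ⊆ E` such that the image of `t` in `H¹(E, G)` comes from `H¹(M, G)`. -/
def essDim (k : Type u) [Field k] (l : ℕ) {F : Type u} [Field F] [Algebra k F]
    (t : GaloisAlgebra G F) : ℕ∞ :=
  ⨅ (E : Type u) (_ : Field E) (_ : Algebra k E) (_ : Algebra F E) (_ : IsScalarTower k F E)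
    (_ : FiniteDimensional F E) (_ : ¬ l ∣ Module.finrank F E)
    (M : IntermediateField k E) (_ : ∃ s : GaloisAlgebra G M, t.SameOver s E),
    Cardinal.toENat (Algebra.trdeg k M)

end GaloisAlgebra

/-- The essential `l`-dimension `ed_k(G, l)` of a finite group `G`: the supremum of `ed_k(t, l)`
over all field extensions `F / k` and all `G`-torsors `t` over `Spec F`. -/
def essDim (k : Type u) [Field k] (G : Type v) [Group G] (l : ℕ) : ℕ∞ :=
  ⨆ (F : Type u) (_ : Field F) (_ : Algebra k F) (t : GaloisAlgebra G F), t.essDim k l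

/-! ### Unitary groups over finite fields -/

/-- The unitary group `{M ∈ GL_n(K) : Mᵀ β σ(M) = β}` of a matrix `β` with respect to a ring
endomorphism `σ` of `K`, applied entrywise. -/
def hermitianUnitaryGroup {K : Type v} [Field K] {n : ℕ} (σ : K →+* K) (β : Matrix (Fin n) (Fin n) K) :
    Subgroup (GL (Fin n) K) where
  carrier := {M | M.valᵀ * β * M.val.map σ = β}
  one_mem' := by simp
  mul_mem' := by
    intro A B hA hB
    simp only [Set.mem_setOf_eq, Units.val_mul, Matrix.transpose_mul, Matrix.map_mul] at *
    calc B.valᵀ * A.valᵀ * β * (A.val.map σ * B.val.map σ)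
        = B.valᵀ * (A.valᵀ * β * A.val.map σ) * B.val.map σ := by simp only [Matrix.mul_assoc]
      _ = β := by rw [hA, hB]
  inv_mem' := by
    intro A hA
    simp only [Set.mem_setOf_eq] at *
    have h1 : (A⁻¹).valᵀ * A.valᵀ = 1 := by
      rw [← Matrix.transpose_mul, ← Units.val_mul, mul_inv_cancel]; simp
    have h2 : A.val.map σ * (A⁻¹).val.map σ = 1 := by
      rw [← Matrix.map_mul, ← Units.val_mul, mul_inv_cancel]; simp
    calc (A⁻¹).valᵀ * β * (A⁻¹).val.map σ
        = (A⁻¹).valᵀ * (A.valᵀ * β * A.val.map σ) * (A⁻¹).val.map σ := by rw [hA]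
      _ = ((A⁻¹).valᵀ * A.valᵀ) * β * (A.val.map σ * (A⁻¹).val.map σ) := by
          simp only [Matrix.mul_assoc]
      _ = β := by rw [h1, h2, one_mul, mul_one]

/-- The nontrivial automorphism `a ↦ a ^ q` of `𝔽_{q²}` over `𝔽_q`, where `q = p ^ r`. -/
def conjFq (p r : ℕ) [Fact p.Prime] : GaloisField p (2 * r) →+* GaloisField p (2 * r) :=
  iterateFrobenius (GaloisField p (2 * r)) p r

/-- `U(n, q²)` for `q = p ^ r`, with respect to the Hermitian matrix `β`. -/
abbrev UnitaryFq (p r n : ℕ) [Fact p.Prime]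
    (β : Matrix (Fin n) (Fin n) (GaloisField p (2 * r))) :
    Subgroup (GL (Fin n) (GaloisField p (2 * r))) :=
  hermitianUnitaryGroup (conjFq p r) β

end

/-! Essential `l`-dimension does not change on passing to a subgroup `H` of `G` of index prime to
`l` (`essDim_eq_of_not_dvd_index`); the rest is an embedding and a comparison of orders.

For `≤` from `H` to `G`, induce an `H`-torsor `s` to `G`. If the induced torsor descends over `E` to
`t` over `M`, then `s` gives an `E`-point of the finite `M`-scheme `t/H`. This point is defined over
the algebraic closure `N` of `M` in `E`, which has the same transcendence degree, and it cuts out of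
`t` an `H`-torsor over `N` descending `s`. For the converse, `t/H` has degree `[G : H]` over `F`, so
some residue field has degree prime to `l`. Over it `t` comes from an `H`-torsor, and any descent of
that torsor can be induced back to `G`.

Counting orthonormal bases gives `|U(n, q²)| = ∏ q^i (q^(i+1) - (-1)^(i+1))`. The index of `U(n,
q²)` in `GL_n` is then, up to powers of `q`, the product of the `q^j + (-1)^j` for `1 ≤ j ≤ n`,
which is prime to `l` when `d ≡ 2 mod 4`. Otherwise `GL_m` with `m = ⌊n/2⌋` is embedded in the
unitary group by its action on a Lagrangian of a hyperbolic summand. The index is, up to powers of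
`q`, the product of the `q^j + 1` over odd `j ≤ n`, and `l` divides none of these. -/

/-! ### Galois actions over a commutative base ring, needed because the invariants of a subgroup are
rarely a field. -/

section GaloisAction

/-- An action of a finite group on a commutative `R`-algebra `L` is Galois if the invariants come
from `R`, some element has trace one, and there are Galois coordinates `x i`, `y i`. -/
structure IsGaloisAction {G R L : Type*} [Group G] [Fintype G] [CommRing R] [CommRing L]
    [Algebra R L] (ρ : G →* (L ≃ₐ[R] L)) : Prop where
  exists_algebraMap_eq : ∀ x : L, (∀ g, ρ g x = x) → ∃ a, algebraMap R L a = x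
  exists_trace_eq_one : ∃ c : L, ∑ g, ρ g c = 1
  exists_coords : ∃ (m : ℕ) (x y : Fin m → L),
    ∑ i, x i * y i = 1 ∧ ∀ g, g ≠ 1 → ∑ i, x i * ρ g (y i) = 0

variable {G H R L L' : Type*} [Group G] [Group H] [CommRing R] [CommRing L] [Algebra R L]
  [CommRing L'] [Algebra R L']

theorem apply_sum_action [Fintype G] (ρ : G →* (L ≃ₐ[R] L)) (g : G) (x : L) :
    ρ g (∑ h, ρ h x) = ∑ h, ρ h x := by
  rw [map_sum]
  refine Fintype.sum_equiv (Equiv.mulLeft g) _ _ fun h => ?_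
  simp

theorem exists_coords_of_fintype {ι : Type*} [Fintype ι] (ρ : G →* (L ≃ₐ[R] L)) (x y : ι → L)
    (h1 : ∑ i, x i * y i = 1) (h2 : ∀ g, g ≠ 1 → ∑ i, x i * ρ g (y i) = 0) :
    ∃ (m : ℕ) (x y : Fin m → L), ∑ i, x i * y i = 1 ∧ ∀ g, g ≠ 1 → ∑ i, x i * ρ g (y i) = 0 := by
  let e := Fintype.equivFin ι
  refine ⟨_, x ∘ e.symm, y ∘ e.symm, ?_, fun g hg => ?_⟩
  · rw [← h1]; exact Fintype.sum_equiv e.symm _ _ fun i => rfl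
  · rw [← h2 g hg]; exact Fintype.sum_equiv e.symm _ _ fun i => rfl

/-- Galois coordinates act as dual bases for the trace form. -/
theorem sum_coords_mul_trace [Fintype G] (ρ : G →* (L ≃ₐ[R] L)) {m : ℕ} {x y : Fin m → L}
    (h1 : ∑ i, x i * y i = 1) (h2 : ∀ g, g ≠ 1 → ∑ i, x i * ρ g (y i) = 0) (z : L) :
    ∑ i, x i * ∑ g, ρ g (y i * z) = z := by
  classical
  simp only [Finset.mul_sum, map_mul]
  rw [Finset.sum_comm, Finset.sum_eq_single (1 : G)]
  · simp only [map_one, AlgEquiv.one_apply, ← mul_assoc, ← Finset.sum_mul, h1, one_mul]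
  · intro g _ hg
    simp only [← mul_assoc, ← Finset.sum_mul, h2 g hg, zero_mul]
  · simp

namespace IsGaloisAction

variable [Fintype G]

theorem exists_algebraMap_trace {ρ : G →* (L ≃ₐ[R] L)} (hρ : IsGaloisAction ρ) (x : L) :
    ∃ a, algebraMap R L a = ∑ g, ρ g x :=
  hρ.exists_algebraMap_eq _ fun g => apply_sum_action ρ g x

/-- By the dual basis identity `sum_coords_mul_trace`, the `x i` generate `L`. -/
theorem finite {ρ : G →* (L ≃ₐ[R] L)} (hρ : IsGaloisAction ρ) : Module.Finite R L := by
  obtain ⟨m, x, y, h1, h2⟩ := hρ.exists_coords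
  classical
  refine ⟨⟨Finset.univ.image x, ?_⟩⟩
  rw [eq_top_iff]
  rintro z -
  rw [← sum_coords_mul_trace ρ h1 h2 z]
  refine Submodule.sum_mem _ fun i _ => ?_
  obtain ⟨a, ha⟩ := hρ.exists_algebraMap_trace (y i * z)
  rw [← ha, mul_comm, ← Algebra.smul_def]
  exact Submodule.smul_mem _ _ (Submodule.subset_span (by simp))

/-- Equivariant maps between Galois algebras are isomorphisms. -/
theorem bijective_of_equivariant {ρ : G →* (L ≃ₐ[R] L)} {ρ' : G →* (L' ≃ₐ[R] L')}
    (hρ : IsGaloisAction ρ) (hρ' : IsGaloisAction ρ')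
    (hinj : Function.Injective (algebraMap R L')) (f : L →ₐ[R] L')
    (hf : ∀ g x, f (ρ g x) = ρ' g (f x)) : Function.Bijective f := by
  obtain ⟨m, x, y, h1, h2⟩ := hρ.exists_coords
  constructor
  -- The coordinates of `z` are traces, hence scalars; `f` kills these scalars and `R` injects into
  -- `L'`, so they vanish.
  · rw [injective_iff_map_eq_zero]
    intro z hz
    rw [← sum_coords_mul_trace ρ h1 h2 z]
    refine Finset.sum_eq_zero fun i _ => ?_
    obtain ⟨a, ha⟩ := hρ.exists_algebraMap_trace (y i * z)
    have h0 : f (∑ g, ρ g (y i * z)) = 0 := by simp [hf, hz]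
    rw [← ha, AlgHom.commutes] at h0
    rw [← ha, hinj (h0.trans (map_zero _).symm), map_zero, mul_zero]
  · intro z
    have h1' : ∑ i, f (x i) * f (y i) = 1 := by simpa using congrArg f h1
    have h2' : ∀ g, g ≠ 1 → ∑ i, f (x i) * ρ' g (f (y i)) = 0 := fun g hg => by
      simpa [hf] using congrArg f (h2 g hg)
    choose a ha using fun i => hρ'.exists_algebraMap_trace (f (y i) * z)
    refine ⟨∑ i, x i * algebraMap R L (a i), ?_⟩
    rw [← sum_coords_mul_trace ρ' h1' h2' z]
    simp [ha]

end IsGaloisAction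

/-- The action on a base change. -/
noncomputable def baseChangeAction (ρ : G →* (L ≃ₐ[R] L)) (R' : Type*) [CommRing R'] [Algebra R R'] :
    G →* (R' ⊗[R] L ≃ₐ[R'] R' ⊗[R] L) where
  toFun g := Algebra.TensorProduct.congr AlgEquiv.refl (ρ g)
  map_one' := by
    ext x
    induction x using TensorProduct.induction_on with
    | zero => simp
    | tmul a b => simp
    | add a b ha hb => rw [map_add, map_add, ha, hb]
  map_mul' g h := by
    ext x
    induction x using TensorProduct.induction_on with
    | zero => simp
    | tmul a b => simp
    | add a b ha hb => rw [map_add, map_add, ha, hb]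

@[simp]
theorem baseChangeAction_tmul (ρ : G →* (L ≃ₐ[R] L)) (R' : Type*) [CommRing R'] [Algebra R R']
    (g : G) (a : R') (b : L) : baseChangeAction ρ R' g (a ⊗ₜ b) = a ⊗ₜ ρ g b := by
  simp [baseChangeAction]

theorem IsGaloisAction.baseChange [Fintype G] {ρ : G →* (L ≃ₐ[R] L)} (hρ : IsGaloisAction ρ)
    (R' : Type*) [CommRing R'] [Algebra R R'] : IsGaloisAction (baseChangeAction ρ R') := by
  obtain ⟨c, hc⟩ := hρ.exists_trace_eq_one
  obtain ⟨m, x, y, h1, h2⟩ := hρ.exists_coords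
  refine ⟨fun z hz => ?_, ⟨1 ⊗ₜ c, ?_⟩, m, fun i => 1 ⊗ₜ x i, fun i => 1 ⊗ₜ y i, ?_, fun g hg => ?_⟩
  -- Traces are scalars, as pure tensors show; an invariant `z` is the trace of `z * (1 ⊗ c)` with
  -- `c` of trace one.
  · have key : ∀ w : R' ⊗[R] L, ∃ a, algebraMap R' _ a = ∑ g, baseChangeAction ρ R' g w := by
      intro w
      induction w using TensorProduct.induction_on with
      | zero => exact ⟨0, by simp⟩
      | tmul a b =>
        obtain ⟨s, hs⟩ := hρ.exists_algebraMap_trace b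
        refine ⟨s • a, ?_⟩
        simp only [baseChangeAction_tmul, ← TensorProduct.tmul_sum, ← hs]
        rw [Algebra.algebraMap_eq_smul_one s, ← TensorProduct.smul_tmul]
        rfl
      | add a b ha hb =>
        obtain ⟨s, hs⟩ := ha
        obtain ⟨s', hs'⟩ := hb
        exact ⟨s + s', by simp only [map_add, Finset.sum_add_distrib, hs, hs']⟩
    obtain ⟨a, ha⟩ := key (z * (1 ⊗ₜ c))
    refine ⟨a, ha.trans ?_⟩
    simp only [map_mul, hz, baseChangeAction_tmul]
    rw [← Finset.mul_sum, ← TensorProduct.tmul_sum, hc, ← Algebra.TensorProduct.one_def, mul_one]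
  · simp only [baseChangeAction_tmul]
    rw [← TensorProduct.tmul_sum, hc, Algebra.TensorProduct.one_def]
  · simp only [Algebra.TensorProduct.tmul_mul_tmul, mul_one]
    rw [← TensorProduct.tmul_sum, h1, Algebra.TensorProduct.one_def]
  · simp only [baseChangeAction_tmul, Algebra.TensorProduct.tmul_mul_tmul, mul_one]
    rw [← TensorProduct.tmul_sum, h2 g hg, TensorProduct.tmul_zero]

/-- The base ring is a direct summand of a Galois algebra, so base change keeps it nonzero. -/
theorem IsGaloisAction.nontrivial_baseChange [Fintype G] {ρ : G →* (L ≃ₐ[R] L)} (hρ : IsGaloisAction ρ)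
    (hinj : Function.Injective (algebraMap R L)) (R' : Type*) [CommRing R'] [Nontrivial R']
    [Algebra R R'] : Nontrivial (R' ⊗[R] L) := by
  obtain ⟨c, hc⟩ := hρ.exists_trace_eq_one
  choose τ hτ using fun x => hρ.exists_algebraMap_trace x
  let π : L →ₗ[R] R :=
    { toFun := fun x => τ (c * x)
      map_add' := fun a b => hinj (by simp [hτ, mul_add, Finset.sum_add_distrib])
      map_smul' := fun a b => hinj (by
        simp [hτ, Algebra.smul_def, Finset.mul_sum, mul_left_comm]) }
  have hπ : π 1 = 1 := hinj (by simp [π, hτ, hc])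
  let retr : R' ⊗[R] L →ₗ[R] R' := (TensorProduct.rid R R').toLinearMap ∘ₗ π.lTensor R'
  refine nontrivial_of_ne (1 : R' ⊗[R] L) 0 fun h => ?_
  have := congrArg retr h
  simp [retr, Algebra.TensorProduct.one_def, hπ] at this

/-! ### Restriction to a subgroup -/

/-- The invariants of a group homomorphism into the automorphisms, as a subalgebra. -/
def invariantSubalgebra (ρ : G →* (L ≃ₐ[R] L)) (φ : H →* G) : Subalgebra R L where
  carrier := {x | ∀ h, ρ (φ h) x = x}
  mul_mem' ha hb h := by rw [map_mul, ha h, hb h]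
  add_mem' ha hb h := by rw [map_add, ha h, hb h]
  algebraMap_mem' a h := by simp

/-- The action of `H` on `L`, linear over the invariants. -/
def restrictAction (ρ : G →* (L ≃ₐ[R] L)) (φ : H →* G) :
    H →* (L ≃ₐ[invariantSubalgebra ρ φ] L) where
  toFun h := AlgEquiv.ofRingEquiv (f := (ρ (φ h)).toRingEquiv) fun a => a.2 h
  map_one' := by ext x; simp
  map_mul' a b := by
    ext x
    change ρ (φ (a * b)) x = ρ (φ a) (ρ (φ b) x)
    simp

@[simp]
theorem restrictAction_apply (ρ : G →* (L ≃ₐ[R] L)) (φ : H →* G) (h : H) (x : L) :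
    restrictAction ρ φ h x = ρ (φ h) x := rfl

theorem sum_eq_sum_quotient_sum [Fintype G] [Fintype H] {M : Type*} [AddCommMonoid M] {φ : H →* G}
    (hφ : Function.Injective φ) (f : G → M) :
    letI := Fintype.ofFinite (G ⧸ φ.range)
    ∑ g, f g = ∑ r : G ⧸ φ.range, ∑ h, f (r.out * φ h) := by
  let := Fintype.ofFinite (G ⧸ φ.range)
  rw [← Fintype.sum_prod_type' (f := fun (r : G ⧸ φ.range) h => f (r.out * φ h))]
  symm
  refine Fintype.sum_bijective (fun p : (G ⧸ φ.range) × H => p.1.out * φ p.2) ⟨?_, ?_⟩ _ _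
    fun _ => rfl
  · rintro ⟨r, h⟩ ⟨r', h'⟩ e
    simp only at e
    have hr : r = r' := by
      rw [← r.out_eq', ← r'.out_eq']
      refine QuotientGroup.eq.2 ?_
      refine ⟨h * h'⁻¹, ?_⟩
      rw [map_mul, map_inv, eq_inv_mul_iff_mul_eq, ← mul_assoc, e, mul_inv_cancel_right]
    subst hr
    exact Prod.ext rfl (hφ (mul_left_cancel e))
  · intro g
    obtain ⟨h, hh⟩ := (QuotientGroup.eq.1 (Quotient.out_eq' (QuotientGroup.mk (s := φ.range) g)))
    exact ⟨⟨QuotientGroup.mk g, h⟩, by simp [hh]⟩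

/-- The same coordinates serve for the subgroup. Summing `c` over inverses of coset representatives
splits the full trace into a trace over `H`. -/
theorem IsGaloisAction.restrict [Fintype G] [Fintype H] {ρ : G →* (L ≃ₐ[R] L)}
    (hρ : IsGaloisAction ρ) {φ : H →* G}
    (hφ : Function.Injective φ) : IsGaloisAction (restrictAction ρ φ) := by
  obtain ⟨c, hc⟩ := hρ.exists_trace_eq_one
  obtain ⟨m, x, y, h1, h2⟩ := hρ.exists_coords
  refine ⟨fun z hz => ⟨⟨z, hz⟩, rfl⟩, ?_, m, x, y, h1, fun h hh => h2 _ fun e => hh ?_⟩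
  · let := Fintype.ofFinite (G ⧸ φ.range)
    refine ⟨∑ r : G ⧸ φ.range, ρ r.out⁻¹ c, ?_⟩
    rw [← hc, ← Equiv.sum_comp (Equiv.inv G), sum_eq_sum_quotient_sum hφ, Finset.sum_comm]
    rw [← Equiv.sum_comp (Equiv.inv H)]
    simp only [restrictAction_apply, Equiv.inv_apply]
    simp only [map_sum, mul_inv_rev, map_mul, AlgEquiv.mul_apply, map_inv]
  · exact hφ (e.trans (map_one φ).symm)

/-! ### Induction from a subgroup -/

/-- The induced algebra: functions `f : G → L` with `f (φ h * g) = h • f g`. -/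
def inducedSubalgebra (σ : H →* (L ≃ₐ[R] L)) (φ : H →* G) : Subalgebra R (G → L) where
  carrier := {f | ∀ h g, f (φ h * g) = σ h (f g)}
  mul_mem' ha hb h g := by simp [ha h g, hb h g]
  add_mem' ha hb h g := by simp [ha h g, hb h g]
  algebraMap_mem' a h g := by simp

/-- The action of `G` on the induced algebra by right translation. -/
def inducedAction (σ : H →* (L ≃ₐ[R] L)) (φ : H →* G) :
    G →* (inducedSubalgebra σ φ ≃ₐ[R] inducedSubalgebra σ φ) where
  toFun g := AlgEquiv.ofAlgHom
    { toFun := fun f => ⟨fun x => f.1 (x * g), fun h x => by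
        change f.1 (φ h * x * g) = _
        rw [mul_assoc, f.2]⟩
      map_one' := rfl
      map_mul' := fun _ _ => rfl
      map_zero' := rfl
      map_add' := fun _ _ => rfl
      commutes' := fun _ => rfl }
    { toFun := fun f => ⟨fun x => f.1 (x * g⁻¹), fun h x => by
        change f.1 (φ h * x * g⁻¹) = _
        rw [mul_assoc, f.2]⟩
      map_one' := rfl
      map_mul' := fun _ _ => rfl
      map_zero' := rfl
      map_add' := fun _ _ => rfl
      commutes' := fun _ => rfl }
    (by
      ext f x
      change f.1 (x * g * g⁻¹) = f.1 x
      rw [mul_inv_cancel_right])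
    (by
      ext f x
      change f.1 (x * g⁻¹ * g) = f.1 x
      rw [inv_mul_cancel_right])
  map_one' := by
    ext f x
    change f.1 (x * 1) = f.1 x
    rw [mul_one]
  map_mul' a b := by
    ext f x
    change f.1 (x * (a * b)) = f.1 (x * a * b)
    rw [mul_assoc]

@[simp]
theorem inducedAction_apply (σ : H →* (L ≃ₐ[R] L)) (φ : H →* G) (g : G)
    (f : inducedSubalgebra σ φ) (x : G) : (inducedAction σ φ g f).1 x = f.1 (x * g) := rfl

open Classical in
/-- Extension by zero of an element of `L` to the induced algebra. -/
noncomputable def extendByZero (σ : H →* (L ≃ₐ[R] L)) {φ : H →* G} (hφ : Function.Injective φ)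
    (a : L) : inducedSubalgebra σ φ :=
  ⟨fun g => if hg : ∃ h, φ h = g then σ hg.choose a else 0, fun h g => by
    by_cases hg : ∃ h', φ h' = g
    · obtain ⟨h', rfl⟩ := hg
      have e1 : ∃ h'', φ h'' = φ h * φ h' := ⟨h * h', map_mul _ _ _⟩
      have e2 : ∃ h'', φ h'' = φ h' := ⟨h', rfl⟩
      simp only [dif_pos e1, dif_pos e2]
      have a1 : e1.choose = h * h' := hφ (e1.choose_spec.trans (map_mul _ _ _).symm)
      have a2 : e2.choose = h' := hφ e2.choose_spec
      rw [a1, a2, map_mul, AlgEquiv.mul_apply]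
    · have e1 : ¬ ∃ h'', φ h'' = φ h * g := fun ⟨h'', e⟩ =>
        hg ⟨h⁻¹ * h'', by rw [map_mul, e, map_inv, inv_mul_cancel_left]⟩
      simp only [dif_neg e1, dif_neg hg, map_zero]⟩

theorem extendByZero_apply (σ : H →* (L ≃ₐ[R] L)) {φ : H →* G} (hφ : Function.Injective φ)
    (a : L) (h : H) : (extendByZero σ hφ a).1 (φ h) = σ h a := by
  have e : ∃ h', φ h' = φ h := ⟨h, rfl⟩
  have : e.choose = h := hφ e.choose_spec
  simp only [extendByZero, dif_pos e, this]

theorem extendByZero_apply_of_notMem (σ : H →* (L ≃ₐ[R] L)) {φ : H →* G}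
    (hφ : Function.Injective φ) (a : L) {g : G} (hg : g ∉ φ.range) :
    (extendByZero σ hφ a).1 g = 0 := by
  have : ¬ ∃ h, φ h = g := hg
  simp only [extendByZero, dif_neg this]

/-- The induced algebra is a product of copies of `L` indexed by cosets. Invariant functions are
constant, extension by zero preserves trace one, and coordinates are the translates of the old ones,
extended by zero, by coset representatives. -/
theorem IsGaloisAction.induced [Fintype G] [Fintype H] {σ : H →* (L ≃ₐ[R] L)}
    (hσ : IsGaloisAction σ) {φ : H →* G}
    (hφ : Function.Injective φ) : IsGaloisAction (inducedAction σ φ) := by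
  classical
  let := Fintype.ofFinite (G ⧸ φ.range)
  obtain ⟨c, hc⟩ := hσ.exists_trace_eq_one
  obtain ⟨m, x, y, h1, h2⟩ := hσ.exists_coords
  have hsupp : ∀ u g a b, (extendByZero σ hφ a).1 u * (extendByZero σ hφ b).1 (u * g) ≠ 0 →
      ∃ h h', u = φ h ∧ g = φ h' := by
    intro u g a b hne
    have hu : u ∈ φ.range := by
      by_contra hu
      exact hne (by rw [extendByZero_apply_of_notMem σ hφ _ hu, zero_mul])
    have hug : u * g ∈ φ.range := by
      by_contra hu
      exact hne (by rw [extendByZero_apply_of_notMem σ hφ _ hu, mul_zero])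
    obtain ⟨h, rfl⟩ := hu
    obtain ⟨h', hh'⟩ := hug
    exact ⟨h, h⁻¹ * h', rfl, by rw [map_mul, hh', map_inv, inv_mul_cancel_left]⟩
  refine ⟨fun f hf => ?_, ⟨extendByZero σ hφ c, ?_⟩,
    exists_coords_of_fintype (ι := (G ⧸ φ.range) × Fin m) _
      (fun p => inducedAction σ φ p.1.out (extendByZero σ hφ (x p.2)))
      (fun p => inducedAction σ φ p.1.out (extendByZero σ hφ (y p.2))) ?_ fun g hg => ?_⟩
  · have hconst : ∀ g, f.1 g = f.1 1 := fun g => by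
      conv_rhs => rw [← hf g]
      simp
    obtain ⟨a, ha⟩ := hσ.exists_algebraMap_eq (f.1 1) fun h => by
      rw [← f.2 h 1, hconst]
    refine ⟨a, Subtype.ext (funext fun g => ?_)⟩
    rw [hconst g, ← ha]; rfl
  · refine Subtype.ext (funext fun u => ?_)
    simp only [AddSubmonoidClass.coe_finsetSum, Finset.sum_apply, inducedAction_apply]
    rw [Fintype.sum_equiv (Equiv.mulLeft u) (fun g => (extendByZero σ hφ c).1 (u * g))
      (fun g => (extendByZero σ hφ c).1 g) fun _ => rfl]
    rw [← Finset.sum_subset (Finset.subset_univ (Finset.univ.image φ))]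
    · rw [Finset.sum_image fun a _ b _ e => hφ e]
      simp only [extendByZero_apply, hc]; rfl
    · intro g _ hg
      exact extendByZero_apply_of_notMem σ hφ _ fun ⟨h, hh⟩ => hg (by simp [← hh])
  · refine Subtype.ext (funext fun u => ?_)
    rw [Fintype.sum_prod_type]
    simp only [AddSubmonoidClass.coe_finsetSum, Finset.sum_apply, inducedAction_apply,
      MulMemClass.coe_mul, Pi.mul_apply]
    -- The translate by `r.out` is nonzero at `u` only if `u * r.out` lies in `H`, which singles out
    -- the coset of `u⁻¹`.
    rw [Finset.sum_eq_single (QuotientGroup.mk (s := φ.range) u⁻¹)]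
    · obtain ⟨h, hh⟩ := (QuotientGroup.eq.1 (Quotient.out_eq' (QuotientGroup.mk (s := φ.range) u⁻¹)))
      have hh' : u * (Quotient.out (QuotientGroup.mk (s := φ.range) u⁻¹)) = φ h⁻¹ := by
        rw [map_inv, hh]; simp
      simp only [hh', extendByZero_apply, ← map_mul, ← map_sum, h1, map_one]; rfl
    · intro r _ hr
      refine Finset.sum_eq_zero fun i _ => ?_
      rw [extendByZero_apply_of_notMem, zero_mul]
      intro hu
      refine hr ?_
      rw [← r.out_eq']
      refine QuotientGroup.eq.2 ?_
      rw [← mul_inv_rev]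
      exact inv_mem hu
    · simp
  · refine Subtype.ext (funext fun u => ?_)
    rw [Fintype.sum_prod_type]
    simp only [AddSubmonoidClass.coe_finsetSum, Finset.sum_apply, inducedAction_apply,
      MulMemClass.coe_mul, Pi.mul_apply, ZeroMemClass.coe_zero, Pi.zero_apply]
    refine Finset.sum_eq_zero fun r _ => ?_
    by_contra hne
    obtain ⟨i, -, hi⟩ := Finset.exists_ne_zero_of_sum_ne_zero hne
    -- A nonzero term forces the conjugate of `g` by `r.out` into `H`; it is not `1`, so the
    -- coordinate relation for `H` kills the sum.
    have e : u * g * r.out = u * r.out * (r.out⁻¹ * g * r.out) := by group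
    rw [e] at hi
    obtain ⟨h, h', hu, hg'⟩ := hsupp _ _ _ _ hi
    refine hne ?_
    simp only [e]
    simp only [hu, hg', ← map_mul, extendByZero_apply]
    simp only [map_mul, AlgEquiv.mul_apply]
    simp only [← map_mul, ← map_sum]
    rw [h2 h', map_zero]
    rintro rfl
    rw [map_one, mul_assoc, inv_mul_eq_one, eq_comm, mul_eq_right] at hg'
    exact hg hg'

/-- Frobenius reciprocity: an `H`-equivariant ring homomorphism `T → L` gives a `G`-equivariant
ring homomorphism from `T` to the induced algebra. -/
def toInduced {R' T : Type*} [CommRing R'] [CommRing T] [Algebra R' T]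
    (ρ : G →* (T ≃ₐ[R'] T))
    (σ : H →* (L ≃ₐ[R] L)) (φ : H →* G) (f : T →+* L)
    (hf : ∀ h x, f (ρ (φ h) x) = σ h (f x)) : T →+* inducedSubalgebra σ φ where
  toFun x := ⟨fun g => f (ρ g x), fun h g => by
    change f (ρ (φ h * g) x) = _
    rw [map_mul, AlgEquiv.mul_apply, hf]⟩
  map_one' := by ext; simp
  map_mul' a b := by ext; simp
  map_zero' := by ext; simp
  map_add' a b := by ext; simp

theorem toInduced_equivariant {R' T : Type*} [CommRing R'] [CommRing T] [Algebra R' T]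
    (ρ : G →* (T ≃ₐ[R'] T))
    (σ : H →* (L ≃ₐ[R] L)) (φ : H →* G) (f : T →+* L)
    (hf : ∀ h x, f (ρ (φ h) x) = σ h (f x)) (g : G) (x : T) :
    toInduced ρ σ φ f hf (ρ g x) = inducedAction σ φ g (toInduced ρ σ φ f hf x) := by
  refine Subtype.ext (funext fun u => ?_)
  change f (ρ u (ρ g x)) = f (ρ (u * g) x)
  rw [map_mul, AlgEquiv.mul_apply]

/-- Evaluation of an induced function at the identity. -/
def inducedEval (σ : H →* (L ≃ₐ[R] L)) (φ : H →* G) : inducedSubalgebra σ φ →ₐ[R] L :=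
  (Pi.evalAlgHom R (fun _ : G => L) 1).comp (inducedSubalgebra σ φ).val

theorem inducedEval_equivariant (σ : H →* (L ≃ₐ[R] L)) (φ : H →* G) (h : H)
    (f : inducedSubalgebra σ φ) :
    inducedEval σ φ (inducedAction σ φ (φ h) f) = σ h (inducedEval σ φ f) := by
  change f.1 (1 * φ h) = σ h (f.1 1)
  rw [← f.2, one_mul, mul_one]

/-! ### Ring homomorphisms out of a base change -/

/-- The ring homomorphism `R' ⊗[R] L → B` given by ring homomorphisms on `R'` and `L` that agree
on `R`. -/
noncomputable def tensorLift {R' B : Type*} [CommRing R'] [Algebra R R'] [CommRing B]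
    (j : R' →+* B) (f : L →+* B) (h : ∀ a, f (algebraMap R L a) = j (algebraMap R R' a)) :
    R' ⊗[R] L →+* B :=
  letI := (j.comp (algebraMap R R')).toAlgebra
  (Algebra.TensorProduct.lift (R := R) (S := R) (A := R') (B := L) (C := B)
    { j with commutes' := fun _ => rfl } { f with commutes' := h }
    fun _ _ => Commute.all _ _).toRingHom

section

variable {R' B : Type*} [CommRing R'] [Algebra R R'] [CommRing B] (j : R' →+* B) (f : L →+* B)
  (h : ∀ a, f (algebraMap R L a) = j (algebraMap R R' a))

@[simp]
theorem tensorLift_tmul (a : R') (x : L) : tensorLift j f h (a ⊗ₜ x) = j a * f x := by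
  let := (j.comp (algebraMap R R')).toAlgebra
  exact Algebra.TensorProduct.lift_tmul _ _ _ _ _

theorem tensorLift_equivariant (ρ : G →* (L ≃ₐ[R] L)) (g : G) (θ : B →+* B)
    (hj : ∀ a, θ (j a) = j a) (hf : ∀ x, f (ρ g x) = θ (f x)) (w : R' ⊗[R] L) :
    tensorLift j f h (baseChangeAction ρ R' g w) = θ (tensorLift j f h w) := by
  induction w using TensorProduct.induction_on with
  | zero => simp
  | tmul a b => simp [hj, hf]
  | add a b ha hb => simp only [map_add, ha, hb]

end

end GaloisAction

/-! ### Torsors over a field as Galois actions. -/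

section GaloisAlgebra

variable {G : Type v} {F L : Type u} [Group G] [Field F] [CommRing L] [Algebra F L]

theorem galoisMap_tmul (ρ : G →* (L ≃ₐ[F] L)) (a b : L) (g : G) :
    galoisMap ρ (a ⊗ₜ b) g = a * ρ g b := by
  simp [galoisMap]

/-- Applying to the first factor a linear functional `f` with `f 1 ≠ 0` gives `f x • 1 = f 1 • x`.
-/
theorem exists_algebraMap_eq_of_tmul_one_eq [Nontrivial L] {x : L}
    (h : x ⊗ₜ[F] (1 : L) = 1 ⊗ₜ x) : ∃ a, algebraMap F L a = x := by
  obtain ⟨f, hf⟩ := Module.Projective.exists_dual_ne_zero F (one_ne_zero (α := L))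
  have := congrArg (TensorProduct.lid F L ∘ f.rTensor L) h
  simp only [Function.comp_apply, LinearMap.rTensor_tmul, TensorProduct.lid_tmul] at this
  refine ⟨f x / f 1, ?_⟩
  rw [div_eq_inv_mul, map_mul, Algebra.algebraMap_eq_smul_one (f x), this, ← Algebra.smul_def,
    smul_smul, inv_mul_cancel₀ hf, one_smul]

theorem isGaloisAction_of_bijective_galoisMap [Fintype G] [Nontrivial L] {ρ : G →* (L ≃ₐ[F] L)}
    (h : Function.Bijective (galoisMap ρ)) : IsGaloisAction ρ := by
  classical
  have hfix : ∀ x : L, (∀ g, ρ g x = x) → ∃ a, algebraMap F L a = x := fun x hx =>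
    exists_algebraMap_eq_of_tmul_one_eq (h.1 (funext fun g => by
      rw [galoisMap_tmul, galoisMap_tmul, hx, map_one, mul_one, one_mul]))
  -- Galois coordinates are the components of the tensor mapping to the indicator of `1`.
  obtain ⟨w, hw⟩ := h.2 (Pi.single 1 1)
  obtain ⟨s, rfl⟩ := TensorProduct.exists_finset w
  have hw' : ∀ g, ∑ p : s, p.1.1 * ρ g p.1.2 = (Pi.single 1 1 : G → L) g := fun g => by
    rw [← hw, map_sum, Finset.sum_apply, Finset.sum_coe_sort s fun p => p.1 * ρ g p.2]
    simp only [galoisMap_tmul]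
  obtain ⟨m, x, y, h1, h2⟩ := exists_coords_of_fintype ρ (fun p : s => p.1.1) (fun p : s => p.1.2)
    (by simpa using hw' 1) (fun g hg => by simpa [hg] using hw' g)
  refine ⟨hfix, ?_, m, x, y, h1, h2⟩
  -- Expanding `1` in the coordinates shows that some trace is nonzero; over a field it can be
  -- scaled to `1`.
  have h3 := sum_coords_mul_trace ρ h1 h2 1
  obtain ⟨i, -, hi⟩ := Finset.exists_ne_zero_of_sum_ne_zero (h3.trans_ne one_ne_zero)
  obtain ⟨a, ha⟩ := hfix _ fun g => apply_sum_action ρ g (y i * 1)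
  have ha0 : a ≠ 0 := by
    rintro rfl
    rw [map_zero] at ha
    exact hi (by rw [← ha, mul_zero])
  refine ⟨a⁻¹ • (y i * 1), ?_⟩
  simp only [map_smul]
  rw [← Finset.smul_sum, ← ha, inv_smul_eq_iff₀ ha0, Algebra.algebraMap_eq_smul_one]

theorem IsGaloisAction.bijective_galoisMap [Fintype G] {ρ : G →* (L ≃ₐ[F] L)}
    (hρ : IsGaloisAction ρ) : Function.Bijective (galoisMap ρ) := by
  classical
  obtain ⟨m, x, y, h1, h2⟩ := hρ.exists_coords
  constructor
  · rw [injective_iff_map_eq_zero]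
    intro w hw
    -- An explicit left inverse of `galoisMap`, from the expansion of the second tensor factor.
    have key : ∀ w : L ⊗[F] L, w = ∑ i, (∑ g, ρ g (y i) * galoisMap ρ w g) ⊗ₜ[F] x i := by
      intro w
      induction w using TensorProduct.induction_on with
      | zero => simp
      | tmul a b =>
        conv_lhs => rw [← sum_coords_mul_trace ρ h1 h2 b, TensorProduct.tmul_sum]
        refine Finset.sum_congr rfl fun i _ => ?_
        obtain ⟨c, hc⟩ := hρ.exists_algebraMap_trace (y i * b)
        rw [← hc, mul_comm, ← Algebra.smul_def, ← TensorProduct.smul_tmul]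
        congr 1
        rw [Algebra.smul_def, hc, Finset.sum_mul]
        refine Finset.sum_congr rfl fun g _ => ?_
        rw [galoisMap_tmul, map_mul]
        ring
      | add a b ha hb =>
        conv_lhs => rw [ha, hb]
        simp only [map_add, Pi.add_apply, mul_add, Finset.sum_add_distrib, TensorProduct.add_tmul]
    rw [key w, hw]
    simp
  · intro f
    refine ⟨∑ u, ∑ i, (f u * x i) ⊗ₜ ρ u⁻¹ (y i), funext fun g => ?_⟩
    simp only [map_sum, Finset.sum_apply, galoisMap_tmul, mul_assoc, ← Finset.mul_sum]
    simp only [← AlgEquiv.mul_apply, ← map_mul]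
    rw [Finset.sum_eq_single g]
    · simp [h1]
    · intro u _ hu
      rw [h2 _ fun e => hu (mul_inv_eq_one.1 e).symm, mul_zero]
    · simp

namespace GaloisAlgebra

theorem isGaloisAction [Fintype G] (t : GaloisAlgebra G F) : IsGaloisAction t.action :=
  haveI := t.nontrivial
  isGaloisAction_of_bijective_galoisMap t.bijective

theorem baseAction_apply (t : GaloisAlgebra G F) (E : Type u) [Field E] [Algebra F E] (g : G)
    (x : E ⊗[F] t.carrier) : t.baseAction E g x = baseChangeAction t.action E g x := rfl

theorem nontrivial_baseChange (t : GaloisAlgebra G F) (E : Type u) [Field E] [Algebra F E] :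
    Nontrivial (E ⊗[F] t.carrier) :=
  haveI := t.nontrivial
  inferInstance

/-- The Galois algebra of a Galois action on a nonzero algebra. -/
def ofIsGaloisAction [Fintype G] [Nontrivial L] (ρ : G →* (L ≃ₐ[F] L)) (hρ : IsGaloisAction ρ) :
    GaloisAlgebra G F where
  carrier := L
  nontrivial := inferInstance
  action := ρ
  bijective := hρ.bijective_galoisMap

/-- Two torsors that map equivariantly to the same Galois algebra over `E` agree over `E`. -/
theorem SameOver.of_ringHom [Fintype G] {M E A : Type u} [Field M] [Field E] [Algebra F E]
    [Algebra M E] [CommRing A] [Algebra E A] [Nontrivial A] {t : GaloisAlgebra G F}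
    {s : GaloisAlgebra G M} {ρ : G →* (A ≃ₐ[E] A)} (hρ : IsGaloisAction ρ)
    (f : t.carrier →+* A) (hf : ∀ g x, f (t.action g x) = ρ g (f x))
    (hfF : ∀ a, f (algebraMap F _ a) = algebraMap E A (algebraMap F E a))
    (f' : s.carrier →+* A) (hf' : ∀ g x, f' (s.action g x) = ρ g (f' x))
    (hfM : ∀ a, f' (algebraMap M _ a) = algebraMap E A (algebraMap M E a)) : t.SameOver s E := by
  have hinj := FaithfulSMul.algebraMap_injective E A
  let Φ : E ⊗[F] t.carrier →ₐ[E] A :=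
    { tensorLift (algebraMap E A) f hfF with
      commutes' := fun a => by
        change tensorLift (algebraMap E A) f hfF (a ⊗ₜ 1) = _
        simp }
  let Φ' : E ⊗[M] s.carrier →ₐ[E] A :=
    { tensorLift (algebraMap E A) f' hfM with
      commutes' := fun a => by
        change tensorLift (algebraMap E A) f' hfM (a ⊗ₜ 1) = _
        simp }
  have hΦ : ∀ g x, Φ (baseChangeAction t.action E g x) = ρ g (Φ x) := fun g x =>
    tensorLift_equivariant _ _ hfF t.action g ((ρ g : A ≃ₐ[E] A) : A →+* A) (by simp) (hf g) x
  have hΦ' : ∀ g x, Φ' (baseChangeAction s.action E g x) = ρ g (Φ' x) := fun g x =>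
    tensorLift_equivariant _ _ hfM s.action g ((ρ g : A ≃ₐ[E] A) : A →+* A) (by simp) (hf' g) x
  have hb := (t.isGaloisAction.baseChange E).bijective_of_equivariant hρ hinj Φ hΦ
  have hb' := (s.isGaloisAction.baseChange E).bijective_of_equivariant hρ hinj Φ' hΦ'
  let e := AlgEquiv.ofBijective Φ hb
  refine ⟨(AlgEquiv.ofBijective Φ' hb').trans e.symm, fun g x => e.injective ?_⟩
  rw [baseAction_apply, baseAction_apply]
  simp only [AlgEquiv.trans_apply, AlgEquiv.apply_symm_apply]
  change Φ' _ = Φ _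
  rw [hΦ, hΦ']
  congr 1
  exact (e.apply_symm_apply (Φ' x)).symm

end GaloisAlgebra

/-! ### The degree of the invariants of a subgroup -/

variable {H : Type*} [Group H]

/-- The map `L ⊗ L^H → (G ⧸ H → L)`. -/
noncomputable def invariantsGaloisMap (ρ : G →* (L ≃ₐ[F] L)) (φ : H →* G) :
    L ⊗[F] invariantSubalgebra ρ φ →ₗ[F] (G ⧸ φ.range → L) where
  toFun w r := galoisMap ρ ((invariantSubalgebra ρ φ).val.toLinearMap.lTensor L w) r.out
  map_add' a b := by ext; simp
  map_smul' a b := by ext; simp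

theorem invariantsGaloisMap_tmul_mk (ρ : G →* (L ≃ₐ[F] L)) (φ : H →* G) (a : L)
    (b : invariantSubalgebra ρ φ) (g : G) :
    invariantsGaloisMap ρ φ (a ⊗ₜ b) (QuotientGroup.mk g) = a * ρ g b := by
  obtain ⟨h, hh⟩ := (QuotientGroup.eq.1 (Quotient.out_eq' (QuotientGroup.mk (s := φ.range) g)))
  change galoisMap ρ (a ⊗ₜ b.1) _ = _
  rw [galoisMap_tmul]
  congr 1
  conv_lhs => rw [← b.2 h, hh, ← AlgEquiv.mul_apply, ← map_mul, mul_inv_cancel_left]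

theorem galoisMap_lTensor (ρ : G →* (L ≃ₐ[F] L)) (φ : H →* G)
    (w : L ⊗[F] invariantSubalgebra ρ φ) (g : G) :
    galoisMap ρ ((invariantSubalgebra ρ φ).val.toLinearMap.lTensor L w) g =
      invariantsGaloisMap ρ φ w (QuotientGroup.mk g) := by
  induction w using TensorProduct.induction_on with
  | zero => simp
  | tmul a b =>
    rw [invariantsGaloisMap_tmul_mk]
    exact galoisMap_tmul ρ a b.1 g
  | add a b ha hb => simp only [map_add, Pi.add_apply, ha, hb]

/-- Injectivity is inherited from `galoisMap` by flatness. A preimage comes from the one for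
`galoisMap` by replacing the second tensor factors by their traces over `H`. -/
theorem IsGaloisAction.bijective_invariantsGaloisMap [Fintype G] [Fintype H]
    {ρ : G →* (L ≃ₐ[F] L)} (hρ : IsGaloisAction ρ) {φ : H →* G} (hφ : Function.Injective φ) :
    Function.Bijective (invariantsGaloisMap ρ φ) := by
  classical
  let := Fintype.ofFinite (G ⧸ φ.range)
  constructor
  · rw [injective_iff_map_eq_zero]
    intro w hw
    refine Module.Flat.lTensor_preserves_injective_linearMap (M := L)
      (invariantSubalgebra ρ φ).val.toLinearMap Subtype.val_injective ?_
    rw [map_zero]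
    refine hρ.bijective_galoisMap.1 (funext fun g => ?_)
    rw [galoisMap_lTensor, hw]
    simp
  · intro f
    obtain ⟨m, x, y, h1, h2⟩ := hρ.exists_coords
    let tr : L → invariantSubalgebra ρ φ := fun z => ⟨∑ h, ρ (φ h) z, fun h => by
      simpa using apply_sum_action (ρ.comp φ) h z⟩
    refine ⟨∑ r : G ⧸ φ.range, ∑ i, (f r * x i) ⊗ₜ tr (ρ r.out⁻¹ (y i)), funext fun r' => ?_⟩
    obtain ⟨g, rfl⟩ := QuotientGroup.mk_surjective r'
    simp only [map_sum, Finset.sum_apply, invariantsGaloisMap_tmul_mk, tr, mul_assoc,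
      ← Finset.mul_sum]
    simp only [← AlgEquiv.mul_apply, ← map_mul]
    have hswap : ∀ r : G ⧸ φ.range, ∑ i, x i * ∑ h, ρ (g * (φ h * r.out⁻¹)) (y i) =
        ∑ h, ∑ i, x i * ρ (g * (φ h * r.out⁻¹)) (y i) := fun r => by
      simp only [Finset.mul_sum]
      exact Finset.sum_comm
    simp only [hswap]
    rw [Finset.sum_eq_single (QuotientGroup.mk (s := φ.range) g)]
    · obtain ⟨h, hh⟩ := (QuotientGroup.eq.1 (Quotient.out_eq' (QuotientGroup.mk (s := φ.range) g)))
      have hg : g = Quotient.out (QuotientGroup.mk (s := φ.range) g) * φ h := by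
        rw [hh]; simp
      rw [Finset.sum_eq_single h⁻¹]
      · have : g * (φ h⁻¹ * (Quotient.out (QuotientGroup.mk (s := φ.range) g))⁻¹) = 1 := by
          rw [map_inv, ← mul_inv_rev, ← hg, mul_inv_cancel]
        simp only [this, map_one, AlgEquiv.one_apply, h1, mul_one]
      · intro h' _ hne
        refine h2 _ fun e => hne (hφ ?_)
        rw [mul_eq_one_iff_inv_eq, eq_mul_inv_iff_mul_eq, inv_mul_eq_iff_eq_mul] at e
        rw [map_inv, hh, e]
        group
      · simp
    · intro r _ hr
      rw [Finset.sum_eq_zero, mul_zero]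
      intro h _
      refine h2 _ fun e => hr ?_
      rw [← r.out_eq']
      refine QuotientGroup.eq.2 ⟨h⁻¹, ?_⟩
      rw [mul_eq_one_iff_eq_inv, mul_inv_rev, inv_inv] at e
      rw [map_inv, e]; group
    · simp

/-- Compare the dimensions of `L ⊗ L^H` and of the functions `G ⧸ H → L`, then cancel that of `L`.
-/
theorem IsGaloisAction.finrank_invariantSubalgebra [Fintype G] [Fintype H] [Nontrivial L]
    {ρ : G →* (L ≃ₐ[F] L)} (hρ : IsGaloisAction ρ) {φ : H →* G} (hφ : Function.Injective φ) :
    Module.finrank F (invariantSubalgebra ρ φ) = φ.range.index := by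
  have := hρ.finite
  let := Fintype.ofFinite (G ⧸ φ.range)
  have e := LinearEquiv.ofBijective _ (hρ.bijective_invariantsGaloisMap hφ)
  have h := e.finrank_eq
  rw [Module.finrank_tensorProduct, Module.finrank_pi_fintype, Finset.sum_const, Finset.card_univ,
    smul_eq_mul, mul_comm] at h
  rw [Nat.eq_of_mul_eq_mul_right Module.finrank_pos h, Subgroup.index, Nat.card_eq_fintype_card]

end GaloisAlgebra

/-! ### Residue fields of degree prime to `l`. -/

/-- Dévissage: `N` has a finite filtration with quotients `A ⧸ p`, and dimension is additive. -/
theorem dvd_finrank_of_forall_isPrime {F A : Type u} [Field F] [CommRing A] [Algebra F A]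
    [Module.Finite F A] {l : ℕ} (hl : ∀ p : Ideal A, p.IsPrime → l ∣ Module.finrank F (A ⧸ p))
    (N : Type u) [AddCommGroup N] [Module A N] [hN : Module.Finite A N] [Module F N]
    [IsScalarTower F A N] : l ∣ Module.finrank F N := by
  have : IsNoetherianRing A := isNoetherian_of_tower F inferInstance
  refine IsNoetherianRing.induction_on_isQuotientEquivQuotientPrime A (M := N) hN
    (motive := fun N _ _ _ => ∀ [Module F N] [IsScalarTower F A N], l ∣ Module.finrank F N)
    ?_ ?_ ?_
  · intro N _ _ _ _ _ _
    rw [Module.finrank_zero_of_subsingleton]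
    exact dvd_zero l
  · intro N _ _ _ p e _ _
    rw [(e.restrictScalars F).finrank_eq]
    exact hl p.1 p.2
  · intro N₁ _ _ _ N₂ _ _ _ N₃ _ _ _ f g hf hg hfg h1 h3 _ _
    let := Module.compHom N₁ (algebraMap F A)
    let := Module.compHom N₃ (algebraMap F A)
    have : IsScalarTower F A N₁ := ⟨fun a b c => by
      rw [Algebra.smul_def, mul_smul]; rfl⟩
    have : IsScalarTower F A N₃ := ⟨fun a b c => by
      rw [Algebra.smul_def, mul_smul]; rfl⟩
    have : Module.Finite F N₂ := Module.Finite.trans A N₂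
    have hadd := (g.restrictScalars F).finrank_range_add_finrank_ker
    rw [LinearMap.range_eq_top.2 (by exact hg), finrank_top] at hadd
    rw [← hadd]
    refine dvd_add h3 ?_
    have e : LinearMap.ker (g.restrictScalars F) = LinearMap.range (f.restrictScalars F) := by
      ext x
      exact hfg x
    rw [e, LinearMap.finrank_range_of_inj (by exact hf)]
    exact h1

/-- A finite-dimensional algebra of dimension prime to `l` has a residue field of degree prime
to `l`. -/
theorem exists_isMaximal_not_dvd_finrank {F A : Type u} [Field F] [CommRing A] [Algebra F A]
    [Module.Finite F A] {l : ℕ} (h : ¬ l ∣ Module.finrank F A) :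
    ∃ m : Ideal A, m.IsMaximal ∧ ¬ l ∣ Module.finrank F (A ⧸ m) := by
  by_contra! hm
  have : IsArtinianRing A := IsArtinianRing.of_finite F A
  exact h (dvd_finrank_of_forall_isPrime (fun p hp => hm p inferInstance) A)

/-! ### Comparison of essential dimensions -/

namespace GaloisAlgebra

variable {G : Type} {F : Type u} [Group G] [Field F]

theorem essDim_le {k : Type u} [Field k] {l : ℕ} [Algebra k F] (t : GaloisAlgebra G F)
    {E : Type u} [Field E] [Algebra k E] [Algebra F E] [IsScalarTower k F E]
    [hfin : FiniteDimensional F E] (hl : ¬ l ∣ Module.finrank F E) (M : IntermediateField k E)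
    (s : GaloisAlgebra G M) (hs : t.SameOver s E) :
    t.essDim k l ≤ Cardinal.toENat (Algebra.trdeg k M) := by
  unfold GaloisAlgebra.essDim
  refine iInf_le_of_le E (iInf_le_of_le _ (iInf_le_of_le _ (iInf_le_of_le _ (iInf_le_of_le ?_
    (iInf_le_of_le ?_ (iInf_le_of_le hl (iInf_le_of_le M (iInf_le_of_le ⟨s, hs⟩ le_rfl))))))))
  · assumption
  · assumption

variable {H : Type} [Group H]

/-- The `G`-torsor induced from an `H`-torsor. -/
def induced [Fintype G] [Fintype H] (s : GaloisAlgebra H F) {φ : H →* G}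
    (hφ : Function.Injective φ) : GaloisAlgebra G F :=
  haveI := s.nontrivial
  ofIsGaloisAction (inducedAction s.action φ) (s.isGaloisAction.induced hφ)

/-- The restriction of an induced torsor to the subgroup maps to the original torsor. -/
def inducedEval [Fintype G] [Fintype H] (s : GaloisAlgebra H F) {φ : H →* G}
    (hφ : Function.Injective φ) : (s.induced hφ).carrier →ₐ[F] s.carrier :=
  _root_.inducedEval s.action φ

theorem inducedEval_action [Fintype G] [Fintype H] (s : GaloisAlgebra H F) {φ : H →* G}
    (hφ : Function.Injective φ) (h : H) (x : (s.induced hφ).carrier) :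
    s.inducedEval hφ ((s.induced hφ).action (φ h) x) = s.action h (s.inducedEval hφ x) :=
  inducedEval_equivariant s.action φ h x

/-- The `H`-torsor over `N` cut out of a `G`-torsor by an `N`-point of its quotient by `H`. -/
noncomputable def reduction [Fintype G] [Fintype H] (t : GaloisAlgebra G F) {φ : H →* G}
    (hφ : Function.Injective φ) (N : Type u) [Field N]
    [Algebra (invariantSubalgebra t.action φ) N] : GaloisAlgebra H N :=
  haveI := (t.isGaloisAction.restrict hφ).nontrivial_baseChange Subtype.val_injective N
  ofIsGaloisAction _ ((t.isGaloisAction.restrict hφ).baseChange N)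

section reduction

variable [Fintype G] [Fintype H] (t : GaloisAlgebra G F) {φ : H →* G} (hφ : Function.Injective φ)
  (N : Type u) [Field N] [Algebra (invariantSubalgebra t.action φ) N]

/-- The map from a torsor to its reduction. -/
noncomputable def toReduction : t.carrier →+* (t.reduction hφ N).carrier :=
  (Algebra.TensorProduct.includeRight (R := invariantSubalgebra t.action φ) (A := N)
    (B := t.carrier)).toRingHom

theorem toReduction_action (h : H) (x : t.carrier) :
    t.toReduction hφ N (t.action (φ h) x) = (t.reduction hφ N).action h (t.toReduction hφ N x) :=
  (baseChangeAction_tmul (restrictAction t.action φ) N h 1 x).symm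

theorem toReduction_coe (a : invariantSubalgebra t.action φ) :
    t.toReduction hφ N a = algebraMap N _ (algebraMap _ N a) :=
  (Algebra.TensorProduct.includeRight (R := invariantSubalgebra t.action φ) (A := N)
    (B := t.carrier)).commutes a

variable {N} {B : Type*} [CommRing B] (j : N →+* B) (f : t.carrier →+* B)
  (hjf : ∀ a : invariantSubalgebra t.action φ, f a = j (algebraMap _ N a))

/-- The universal property of the reduction of a torsor. -/
noncomputable def reductionLift : (t.reduction hφ N).carrier →+* B :=
  tensorLift (L := t.carrier) (R := invariantSubalgebra t.action φ) j f hjf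

theorem reductionLift_algebraMap (a : N) :
    t.reductionLift hφ j f hjf (algebraMap N _ a) = j a := by
  refine (tensorLift_tmul (L := t.carrier) (R := invariantSubalgebra t.action φ)
    j f hjf a 1).trans ?_
  rw [map_one, mul_one]

theorem reductionLift_action (h : H) (θ : B →+* B) (hj : ∀ a, θ (j a) = j a)
    (hf : ∀ x, f (t.action (φ h) x) = θ (f x)) (x : (t.reduction hφ N).carrier) :
    t.reductionLift hφ j f hjf ((t.reduction hφ N).action h x) =
      θ (t.reductionLift hφ j f hjf x) :=
  tensorLift_equivariant j f hjf (restrictAction t.action φ) h θ hj hf x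

end reduction

/-- The invariants of `H` map to `E` as soon as the torsor maps `H`-equivariantly to an
`H`-Galois algebra over `E`. -/
theorem exists_invariants_ringHom [Fintype H] (t : GaloisAlgebra G F) {φ : H →* G}
    {E B : Type*} [Field E] [CommRing B] [Nontrivial B] [Algebra E B] {σ : H →* (B ≃ₐ[E] B)}
    (hσ : IsGaloisAction σ) (f : t.carrier →+* B) (hf : ∀ h x, f (t.action (φ h) x) = σ h (f x)) :
    ∃ ψ : invariantSubalgebra t.action φ →+* E, ∀ a, algebraMap E B (ψ a) = f a := by
  have hinj := FaithfulSMul.algebraMap_injective E B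
  choose ψ hψ using fun a : invariantSubalgebra t.action φ =>
    hσ.exists_algebraMap_eq (f a) fun h => by rw [← hf, a.2 h]
  exact ⟨{  toFun := ψ
            map_one' := hinj (by simp [hψ])
            map_mul' := fun a b => hinj (by simp [hψ])
            map_zero' := hinj (by simp [hψ])
            map_add' := fun a b => hinj (by simp [hψ]) }, hψ⟩

end GaloisAlgebra

/-- Lets a field of definition be enlarged to its algebraic closure in `E` at no cost. -/
theorem trdeg_restrictScalars_algebraicClosure {k E : Type u} [Field k] [Field E] [Algebra k E]
    (M : IntermediateField k E) :
    Algebra.trdeg k ((algebraicClosure M E).restrictScalars k) = Algebra.trdeg k M := by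
  have : FaithfulSMul M (algebraicClosure M E) :=
    (faithfulSMul_iff_algebraMap_injective _ _).2 (algebraMap M (algebraicClosure M E)).injective
  have := trdeg_add_eq k M (A := algebraicClosure M E)
  rw [trdeg_eq_zero (R := M) (A := algebraicClosure M E), add_zero] at this
  exact this.symm

/-- A descent of the induced torsor yields one of the `H`-torsor, after an algebraic enlargement of
the field of definition. -/
theorem essDim_le_of_injective {G H : Type} [Group G] [Fintype G] [Group H] [Fintype H]
    {φ : H →* G} (hφ : Function.Injective φ) (k : Type u) [Field k] (l : ℕ) :
    essDim k H l ≤ essDim k G l := by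
  refine iSup_le fun F => iSup_le fun _ => iSup_le fun _ => iSup_le fun s => ?_
  refine le_trans ?_ (le_iSup_of_le F (le_iSup_of_le _ (le_iSup_of_le ‹_›
    (le_iSup_of_le (s.induced hφ) le_rfl))))
  refine le_iInf fun E => le_iInf fun _ => le_iInf fun _ => le_iInf fun _ => le_iInf fun _ =>
    le_iInf fun _ => le_iInf fun hl => le_iInf fun M => le_iInf fun ⟨t, e, he⟩ => ?_
  rw [← trdeg_restrictScalars_algebraicClosure M]
  -- Descended torsor, to induced torsor over `E`, to `s` over `E` by evaluation at the identity;
  -- only `H`-equivariant.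
  let f : t.carrier →+* E ⊗[F] s.carrier :=
    ((Algebra.TensorProduct.map (AlgHom.id E E) (s.inducedEval hφ)).comp
      (e : E ⊗[M] t.carrier →ₐ[E] _)).toRingHom.comp
      (Algebra.TensorProduct.includeRight (R := M) (A := E) (B := t.carrier)).toRingHom
  have hev : ∀ h w, Algebra.TensorProduct.map (AlgHom.id E E) (s.inducedEval hφ)
      (baseChangeAction (s.induced hφ).action E (φ h) w) = baseChangeAction s.action E h
        (Algebra.TensorProduct.map (AlgHom.id E E) (s.inducedEval hφ) w) := fun h w => by
    induction w using TensorProduct.induction_on with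
    | zero => simp
    | tmul a b => simp [GaloisAlgebra.inducedEval_action]
    | add a b ha hb => simp only [map_add, ha, hb]
  have hf : ∀ h x, f (t.action (φ h) x) = baseChangeAction s.action E h (f x) := fun h x => by
    have := he (φ h) (1 ⊗ₜ x)
    rw [GaloisAlgebra.baseAction_apply, GaloisAlgebra.baseAction_apply, baseChangeAction_tmul]
      at this
    change Algebra.TensorProduct.map (AlgHom.id E E) (s.inducedEval hφ)
      (e (1 ⊗ₜ t.action (φ h) x)) = _
    rw [this, hev]
    rfl
  have hfM : ∀ a, f (algebraMap M _ a) = algebraMap E _ (algebraMap M E a) := fun a => by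
    change Algebra.TensorProduct.map (AlgHom.id E E) (s.inducedEval hφ)
      (e (1 ⊗ₜ algebraMap M _ a)) = _
    have : (1 : E) ⊗ₜ[M] algebraMap M t.carrier a = algebraMap E _ (algebraMap M E a) := by
      rw [Algebra.algebraMap_eq_smul_one, ← TensorProduct.smul_tmul,
        ← Algebra.algebraMap_eq_smul_one]
      rfl
    rw [this, AlgEquiv.commutes, AlgHom.commutes]
  have := s.nontrivial_baseChange E
  obtain ⟨ψ, hψ⟩ := t.exists_invariants_ringHom (s.isGaloisAction.baseChange E) f hf
  let N := (algebraicClosure M E).restrictScalars k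
  -- The `H`-invariants of `t` are finite over `M`, so `ψ` takes values algebraic over `M`.
  have hψN : ∀ a, ψ a ∈ N := fun a => by
    let ψM : invariantSubalgebra t.action φ →ₐ[M] E :=
      { ψ with
        commutes' := fun c => FaithfulSMul.algebraMap_injective E (E ⊗[F] s.carrier)
          ((hψ _).trans (hfM c)) }
    have := t.isGaloisAction.finite
    have : Algebra.IsIntegral M (invariantSubalgebra t.action φ) := inferInstance
    exact mem_algebraicClosure_iff.2 ((Algebra.IsIntegral.isIntegral (R := M) a).map ψM).isAlgebraic
  let := (ψ.codRestrict N.toSubfield hψN).toAlgebra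
  let j : N →+* E ⊗[F] s.carrier := (algebraMap E _).comp (algebraMap N E)
  have hjf : ∀ a : invariantSubalgebra t.action φ, f a = j (algebraMap _ N a) :=
    fun a => (hψ a).symm
  have hj : ∀ h a, baseChangeAction s.action E h (j a) = j a :=
    fun h a => AlgEquiv.commutes _ _
  refine s.essDim_le hl N (t.reduction hφ N) ?_
  refine .of_ringHom (s.isGaloisAction.baseChange E)
    (Algebra.TensorProduct.includeRight (R := F) (A := E) (B := s.carrier)).toRingHom
    (fun h x => ?_) (fun a => ?_)
    (t.reductionLift hφ j f hjf)
    (fun h x => ?_) (fun a => ?_)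
  · exact (baseChangeAction_tmul s.action E h 1 x).symm
  · exact (Algebra.TensorProduct.includeRight (R := F) (A := E) (B := s.carrier)).commutes a
  · exact t.reductionLift_action hφ j f hjf h
      ((baseChangeAction s.action E h : _ ≃ₐ[E] _) : E ⊗[F] s.carrier →+* E ⊗[F] s.carrier)
      (hj h) (hf h) x
  · exact t.reductionLift_algebraMap hφ j f hjf a

/-- A residue field of the `H`-invariants is a point of the quotient of `t` by `H`; over it `t`
reduces to `H`, and some such field has degree prime to `l`. -/
theorem essDim_le_of_not_dvd_index {G H : Type} [Group G] [Fintype G] [Group H] [Fintype H]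
    {φ : H →* G} (hφ : Function.Injective φ) (k : Type u) [Field k] {l : ℕ} (hl : l.Prime)
    (hi : ¬ l ∣ φ.range.index) : essDim k G l ≤ essDim k H l := by
  refine iSup_le fun F => iSup_le fun _ => iSup_le fun _ => iSup_le fun t => ?_
  have := t.nontrivial
  have := t.isGaloisAction.finite
  rw [← t.isGaloisAction.finrank_invariantSubalgebra hφ] at hi
  obtain ⟨m, hm, hmd⟩ := exists_isMaximal_not_dvd_finrank hi
  let E := invariantSubalgebra t.action φ ⧸ m
  let : Field E := Ideal.Quotient.field m
  let s : GaloisAlgebra H E := t.reduction hφ E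
  let : Algebra k E := ((algebraMap F E).comp (algebraMap k F)).toAlgebra
  have : IsScalarTower k F E := .of_algebraMap_eq fun _ => rfl
  refine le_trans ?_ (le_iSup_of_le E (le_iSup_of_le _ (le_iSup_of_le ‹_›
    (le_iSup_of_le s le_rfl))))
  refine le_iInf fun E' => le_iInf fun _ => le_iInf fun _ => le_iInf fun _ => le_iInf fun _ =>
    le_iInf fun _ => le_iInf fun hl' => le_iInf fun M => le_iInf fun ⟨s', e, he⟩ => ?_
  let : Algebra F E' := ((algebraMap E E').comp (algebraMap F E)).toAlgebra
  have : IsScalarTower F E E' := .of_algebraMap_eq fun _ => rfl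
  have : IsScalarTower k F E' := .of_algebraMap_eq fun a => by
    rw [IsScalarTower.algebraMap_apply k E E']
    rfl
  have : FiniteDimensional F E' := FiniteDimensional.trans F E E'
  have hd : ¬ l ∣ Module.finrank F E' := by
    rw [← Module.finrank_mul_finrank F E E', hl.dvd_mul]
    exact not_or.2 ⟨hmd, hl'⟩
  refine t.essDim_le hd M (s'.induced hφ) ?_
  let f : t.carrier →+* E' ⊗[E] s.carrier :=
    (Algebra.TensorProduct.includeRight (R := E) (A := E') (B := s.carrier)).toRingHom.comp
      (t.toReduction hφ E)
  have hf : ∀ h x, f (t.action (φ h) x) = baseChangeAction s.action E' h (f x) := fun h x => by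
    change 1 ⊗ₜ t.toReduction hφ E (t.action (φ h) x) = baseChangeAction s.action E' h (1 ⊗ₜ _)
    rw [t.toReduction_action, baseChangeAction_tmul]
  let f' : (s'.induced hφ).carrier →+* E' ⊗[E] s.carrier :=
    (e : E' ⊗[M] s'.carrier →ₐ[E'] _).toRingHom.comp
      ((Algebra.TensorProduct.includeRight (R := M) (A := E') (B := s'.carrier)).toRingHom.comp
        (s'.inducedEval hφ).toRingHom)
  have hf' : ∀ h x, f' ((s'.induced hφ).action (φ h) x) = baseChangeAction s.action E' h (f' x) :=
    fun h x => by
    have := he h (1 ⊗ₜ s'.inducedEval hφ x)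
    rw [GaloisAlgebra.baseAction_apply, GaloisAlgebra.baseAction_apply, baseChangeAction_tmul]
      at this
    change e (1 ⊗ₜ s'.inducedEval hφ ((s'.induced hφ).action (φ h) x)) = _
    rw [s'.inducedEval_action, this]
    rfl
  have := s.nontrivial_baseChange E'
  -- By Frobenius reciprocity both `t` and the torsor induced from `s'` map to the algebra induced
  -- from `s` over `E'`.
  refine .of_ringHom ((s.isGaloisAction.baseChange E').induced hφ)
    (toInduced t.action _ φ f hf) (toInduced_equivariant _ _ _ _ _) (fun a => ?_)
    (toInduced (s'.induced hφ).action _ φ f' hf') (toInduced_equivariant _ _ _ _ _) (fun a => ?_)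
  · refine Subtype.ext (funext fun g => ?_)
    change f (t.action g (algebraMap F _ a)) = algebraMap E' _ (algebraMap F E' a)
    rw [AlgEquiv.commutes]
    have hc : t.toReduction hφ E (algebraMap F t.carrier a) =
        algebraMap E _ (algebraMap F E a) := t.toReduction_coe hφ E (algebraMap F _ a)
    change 1 ⊗ₜ t.toReduction hφ E (algebraMap F t.carrier a) = _
    rw [hc]
    exact (Algebra.TensorProduct.includeRight (R := E) (A := E') (B := s.carrier)).commutes _
  · refine Subtype.ext (funext fun g => ?_)
    change f' ((s'.induced hφ).action g (algebraMap M _ a)) = algebraMap E' _ (algebraMap M E' a)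
    rw [AlgEquiv.commutes]
    change e (1 ⊗ₜ s'.inducedEval hφ (algebraMap M _ a)) = _
    rw [AlgHom.commutes]
    refine (congrArg e ((Algebra.TensorProduct.includeRight (R := M) (A := E')
      (B := s'.carrier)).commutes a)).trans ?_
    exact e.commutes _

/-- Essential `l`-dimension does not change under passage to a subgroup of index prime to `l`. -/
theorem essDim_eq_of_not_dvd_index {G H : Type} [Group G] [Finite G] [Group H] {φ : H →* G}
    (hφ : Function.Injective φ) (k : Type u) [Field k] {l : ℕ} (hl : l.Prime)
    (hi : ¬ l ∣ φ.range.index) : essDim k H l = essDim k G l := by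
  have := Finite.of_injective φ hφ
  have := Fintype.ofFinite G
  have := Fintype.ofFinite H
  exact le_antisymm (essDim_le_of_injective hφ k l) (essDim_le_of_not_dvd_index hφ k hl hi)

/-! ### Hermitian forms over finite fields: norms, unit vectors, orthonormal families. -/

section HermitianForms

/-- `σ` is the involution `a ↦ a ^ q` of a field with `q ^ 2` elements. -/
structure IsConjugation {K : Type*} [Field K] (q : ℕ) (σ : K →+* K) : Prop where
  card_eq : Nat.card K = q ^ 2
  one_lt : 1 < q
  apply_eq : ∀ a, σ a = a ^ q

variable {K : Type*} [Field K] {q : ℕ} {σ : K →+* K}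

namespace IsConjugation

theorem finite (hσ : IsConjugation q σ) : Finite K :=
  Nat.finite_of_card_ne_zero (by rw [hσ.card_eq]; exact pow_ne_zero _ (by have := hσ.one_lt; omega))

theorem apply_apply (hσ : IsConjugation q σ) (a : K) : σ (σ a) = a := by
  have := hσ.finite
  have := Fintype.ofFinite K
  rw [hσ.apply_eq, hσ.apply_eq, ← pow_mul, ← sq, ← hσ.card_eq, Nat.card_eq_fintype_card,
    FiniteField.pow_card]

theorem mul_apply (hσ : IsConjugation q σ) (a : K) : a * σ a = a ^ (q + 1) := by
  rw [hσ.apply_eq, pow_succ']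

theorem card_units (hσ : IsConjugation q σ) : Nat.card Kˣ = (q + 1) * (q - 1) := by
  rw [Nat.card_units, hσ.card_eq, ← Nat.sq_sub_sq, one_pow]

theorem exists_apply_ne (hσ : IsConjugation q σ) : ∃ a, σ a ≠ a := by
  by_contra! h
  have := hσ.finite
  -- If `σ` were trivial, a generator of `Kˣ` would have order at most `q - 1`.
  obtain ⟨g, hg⟩ := IsCyclic.exists_ofOrder_eq_natCard (α := Kˣ)
  have h1 : g ^ (q - 1) = 1 := by
    have h2 : g ^ q = g := Units.ext (by simpa [hσ.apply_eq] using h g)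
    have h3 : g ^ (q - 1) * g = 1 * g := by
      rw [← pow_succ, Nat.sub_add_cancel hσ.one_lt.le, h2, one_mul]
    exact mul_right_cancel h3
  have h4 := Nat.le_of_dvd (by have := hσ.one_lt; omega) (orderOf_dvd_of_pow_eq_one h1)
  rw [hg, hσ.card_units] at h4
  have := hσ.one_lt
  nlinarith [Nat.sub_pos_of_lt hσ.one_lt]

/-- If the trace `a + σ a` vanished identically, then `a = 1` would give `2 = 0`, hence `σ a = a`
for all `a`. This covers characteristic two. -/
theorem exists_add_apply_ne_zero (hσ : IsConjugation q σ) {z : K} (hz : z ≠ 0) :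
    ∃ c, c * z + σ (c * z) ≠ 0 := by
  by_contra! h
  have h' : ∀ a, a + σ a = 0 := fun a => by
    simpa [div_mul_cancel₀ a hz] using h (a / z)
  obtain ⟨a, ha⟩ := hσ.exists_apply_ne
  have h1 := h' 1
  rw [map_one] at h1
  refine ha ?_
  have h2 := h' a
  linear_combination h2 - a * h1

/-- The norm is the `(q+1)`-th power on a cyclic group of order `(q+1)(q-1)`: its kernel has order
`q + 1`, and `c ^ (q-1) = 1` makes `c` a `(q+1)`-th power. -/
theorem natCard_norm_eq (hσ : IsConjugation q σ) {c : K} (hc : σ c = c) (hc0 : c ≠ 0) :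
    Nat.card {a : K // a * σ a = c} = q + 1 := by
  have := hσ.finite
  have hq := hσ.one_lt
  let N : Kˣ →* Kˣ := powMonoidHom (q + 1)
  have hker : Nat.card N.ker = q + 1 := by
    rw [IsCyclic.card_powMonoidHom_ker, hσ.card_units]
    exact Nat.gcd_eq_right (Dvd.intro _ rfl)
  obtain ⟨a, ha⟩ : ∃ a, N a = Units.mk0 c hc0 := by
    obtain ⟨g, hg⟩ := IsCyclic.exists_generator (α := Kˣ)
    have hord : orderOf g = (q + 1) * (q - 1) := by
      rw [orderOf_eq_card_of_forall_mem_zpowers hg, hσ.card_units]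
    obtain ⟨m, hm⟩ := mem_powers_iff_mem_zpowers.2 (hg (Units.mk0 c hc0))
    simp only at hm
    have h1 : Units.mk0 c hc0 ^ (q - 1) = 1 := by
      have h2 : Units.mk0 c hc0 ^ (q - 1) * Units.mk0 c hc0 = 1 * Units.mk0 c hc0 := by
        rw [← pow_succ, Nat.sub_add_cancel hq.le, one_mul]
        ext
        simpa [hσ.apply_eq] using hc
      exact mul_right_cancel h2
    rw [← hm, ← pow_mul, ← orderOf_dvd_iff_pow_eq_one, hord] at h1
    obtain ⟨b, rfl⟩ := Nat.dvd_of_mul_dvd_mul_right (by omega) h1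
    exact ⟨g ^ b, by rw [← hm, mul_comm, pow_mul]; rfl⟩
  rw [← hker, ← Nat.card_congr (N.fiberEquivKer a), ha]
  refine Nat.card_congr
    { toFun := fun x => ⟨Units.mk0 x.1 fun h => hc0 ?_, ?_⟩
      invFun := fun x => ⟨x.1, ?_⟩
      left_inv := fun x => rfl
      right_inv := fun x => Subtype.ext (Units.ext rfl) }
  · rw [← x.2, h, zero_mul]
  · refine Units.ext ?_
    change x.1 ^ (q + 1) = c
    rw [← hσ.mul_apply, x.2]
  · rw [hσ.mul_apply]
    exact congrArg Units.val x.2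

theorem exists_norm_eq (hσ : IsConjugation q σ) {c : K} (hc : σ c = c) (hc0 : c ≠ 0) :
    ∃ a, a * σ a = c := by
  have := hσ.natCard_norm_eq hc hc0
  have : Nonempty {a : K // a * σ a = c} := (Nat.card_pos_iff.1 (by omega)).1
  exact ⟨this.some.1, this.some.2⟩

/-- The number of vectors of length `c` in the standard Hermitian space satisfies a linear
recursion in the dimension. -/
theorem natCard_sum_norm_succ (hσ : IsConjugation q σ) {c : K} (hc : σ c = c) (n : ℕ) :
    Nat.card {x : Fin (n + 1) → K // ∑ i, x i * σ (x i) = c} +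
      q * Nat.card {x : Fin n → K // ∑ i, x i * σ (x i) = c} = (q + 1) * q ^ (2 * n) := by
  classical
  have := hσ.finite
  have := Fintype.ofFinite K
  let e : {x : Fin (n + 1) → K // ∑ i, x i * σ (x i) = c} ≃
      Σ w : Fin n → K, {a : K // a * σ a = c - ∑ i, w i * σ (w i)} :=
    { toFun := fun x => ⟨Fin.tail x.1, x.1 0, by
        rw [eq_sub_iff_add_eq]
        exact (Fin.sum_univ_succ _).symm.trans x.2⟩
      invFun := fun p => ⟨Fin.cons p.2.1 p.1, by
        rw [Fin.sum_univ_succ]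
        simp [p.2.2]⟩
      left_inv := fun x => Subtype.ext (Fin.cons_self_tail x.1)
      right_inv := fun p => rfl }
  rw [Nat.card_congr e, Nat.card_sigma]
  -- The first coordinate has `q + 1` values, or only `0` when the others already have length `c`;
  -- the added `q` evens this out.
  have hfib : ∀ w : Fin n → K, Nat.card {a : K // a * σ a = c - ∑ i, w i * σ (w i)} +
      (if ∑ i, w i * σ (w i) = c then q else 0) = q + 1 := by
    intro w
    split_ifs with hw
    · rw [hw, sub_self, add_comm]
      congr 1
      rw [Nat.card_eq_one_iff_unique]
      refine ⟨⟨fun a b => Subtype.ext ?_⟩, ⟨0, by simp⟩⟩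
      have h0 : ∀ a : K, a * σ a = 0 → a = 0 := fun a ha => by simpa using ha
      rw [h0 _ a.2, h0 _ b.2]
    · rw [hσ.natCard_norm_eq _ (sub_ne_zero.2 (Ne.symm hw)), add_zero]
      simp only [map_sub, hc, map_sum, map_mul, hσ.apply_apply]
      congr 1
      exact Finset.sum_congr rfl fun i _ => mul_comm _ _
  have hsum := Finset.sum_congr rfl fun w (_ : w ∈ Finset.univ) => hfib w
  rw [Finset.sum_add_distrib, ← Finset.sum_filter, Finset.sum_const, Finset.sum_const,
    Finset.card_univ, Fintype.card_pi, Finset.prod_const, Finset.card_univ, Fintype.card_fin,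
    ← Nat.card_eq_fintype_card, hσ.card_eq, smul_eq_mul, smul_eq_mul, ← pow_mul] at hsum
  rw [mul_comm (q + 1), ← hsum, Nat.card_eq_fintype_card, Fintype.card_subtype, mul_comm q]

theorem natCard_sum_norm_eq_one (hσ : IsConjugation q σ) (n : ℕ) :
    (Nat.card {x : Fin (n + 1) → K // ∑ i, x i * σ (x i) = 1} : ℤ) =
      q ^ n * (q ^ (n + 1) - (-1) ^ (n + 1)) := by
  induction n with
  | zero =>
    have h := hσ.natCard_sum_norm_succ (map_one σ) 0
    have h0 : Nat.card {x : Fin 0 → K // ∑ i, x i * σ (x i) = 1} = 0 := by simp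
    rw [h0] at h
    have h' : (Nat.card {x : Fin (0 + 1) → K // ∑ i, x i * σ (x i) = 1} : ℤ) = q + 1 := by
      exact_mod_cast (by simpa using h)
    rw [h']
    ring
  | succ n ih =>
    have h := hσ.natCard_sum_norm_succ (map_one σ) (n + 1)
    have h' : (Nat.card {x : Fin (n + 1 + 1) → K // ∑ i, x i * σ (x i) = 1} : ℤ) +
      q * Nat.card {x : Fin (n + 1) → K // ∑ i, x i * σ (x i) = 1} =
        (q + 1) * q ^ (2 * (n + 1)) := by exact_mod_cast h
    rw [ih] at h'
    rw [eq_sub_of_add_eq h']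
    ring

end IsConjugation

/-! ### Orthonormal families -/

variable {V : Type*} [AddCommGroup V] [Module K V] {B : V →ₗ[K] V →ₛₗ[σ] K}

/-- A family of vectors that is orthonormal for the sesquilinear form `B`. -/
structure IsOrthonormalFamily {ι : Type*} (B : V →ₗ[K] V →ₛₗ[σ] K) (v : ι → V) : Prop where
  apply_self : ∀ a, B (v a) (v a) = 1
  apply_of_ne : ∀ a b, a ≠ b → B (v a) (v b) = 0

namespace IsOrthonormalFamily

variable {ι : Type*} {v : ι → V}

theorem sumElim_cons (hB : ∀ x y, B y x = σ (B x y)) {m : ℕ} {w : Fin m → V}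
    (h : IsOrthonormalFamily B (Sum.elim v w)) {x : V} (hx : B x x = 1)
    (hxv : ∀ a, B x (Sum.elim v w a) = 0) :
    IsOrthonormalFamily B (Sum.elim v (Fin.cons x w : Fin (m + 1) → V)) := by
  have hvx : ∀ a, B (Sum.elim v w a) x = 0 := fun a => by rw [hB x, hxv, map_zero]
  constructor
  · rintro (a | a)
    · exact h.apply_self (.inl a)
    · refine Fin.cases hx (fun i => ?_) a
      exact h.apply_self (.inr i)
  · rintro (a | a) (b | b) hab
    · exact h.apply_of_ne (.inl a) (.inl b) (by simpa using hab)
    · refine Fin.cases (hvx (.inl a)) (fun i => ?_) b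
      exact h.apply_of_ne (.inl a) (.inr i) (by simp)
    · refine Fin.cases (hxv (.inl b)) (fun i => ?_) a
      exact h.apply_of_ne (.inr i) (.inl b) (by simp)
    · revert hab
      refine Fin.cases ?_ (fun i => ?_) a
      · refine Fin.cases (fun h => absurd rfl h) (fun j _ => ?_) b
        exact hxv (.inr j)
      · refine Fin.cases (fun _ => hvx (.inr i)) (fun j hij => ?_) b
        exact h.apply_of_ne (.inr i) (.inr j) (by simpa using hij)

variable [Fintype ι]

theorem apply_sum_left (hv : IsOrthonormalFamily B v) (c : ι → K) (b : ι) :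
    B (∑ a, c a • v a) (v b) = c b := by
  classical
  simp only [map_sum, map_smul, LinearMap.sum_apply, LinearMap.smul_apply, smul_eq_mul]
  rw [Finset.sum_eq_single b, hv.apply_self, mul_one]
  · intro a _ hab
    rw [hv.apply_of_ne _ _ hab, mul_zero]
  · simp

theorem linearIndependent (hv : IsOrthonormalFamily B v) : LinearIndependent K v := by
  rw [Fintype.linearIndependent_iff]
  intro c hc b
  rw [← hv.apply_sum_left c b, hc, map_zero, LinearMap.zero_apply]

theorem sum_apply_smul (hv : IsOrthonormalFamily B v) [FiniteDimensional K V]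
    (hcard : Fintype.card ι = Module.finrank K V) (x : V) : ∑ a, B x (v a) • v a = x := by
  classical
  cases isEmpty_or_nonempty ι
  · have : Subsingleton V := Module.finrank_zero_iff.1 (by rw [← hcard]; simp)
    exact Subsingleton.elim _ _
  let b := basisOfLinearIndependentOfCardEqFinrank hv.linearIndependent hcard
  have hb : ∀ a, b a = v a := fun a => by simp [b]
  have hx : x = ∑ a, b.repr x a • v a := by
    conv_lhs => rw [← b.sum_repr x]
    simp only [hb]
  have hc : ∀ a, B x (v a) = b.repr x a := fun a => by
    conv_lhs => rw [hx]
    exact hv.apply_sum_left _ a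
  simp only [hc]
  exact hx.symm

/-- In a nondegenerate Hermitian space, an orthonormal family that is not a basis can be
extended. -/
theorem exists_unit (hσ : IsConjugation q σ) (hB : ∀ x y, B y x = σ (B x y))
    (hnd : ∀ x, (∀ y, B x y = 0) → x = 0) [FiniteDimensional K V] (hv : IsOrthonormalFamily B v)
    (hcard : Fintype.card ι < Module.finrank K V) :
    ∃ x, B x x = 1 ∧ ∀ a, B x (v a) = 0 := by
  by_cases hex : ∃ w, B w w ≠ 0 ∧ ∀ a, B w (v a) = 0
  · obtain ⟨w, hw, hwv⟩ := hex
    obtain ⟨a, ha⟩ := hσ.exists_norm_eq (c := (B w w)⁻¹) (by rw [map_inv₀, ← hB]) (inv_ne_zero hw)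
    refine ⟨a • w, ?_, fun b => ?_⟩
    · simp only [map_smul, LinearMap.smul_apply, smul_eq_mul, LinearMap.map_smulₛₗ]
      rw [← mul_assoc, mul_comm (σ a), ha, inv_mul_cancel₀ hw]
    · simp [hwv b]
  · push Not at hex
    have hiso : ∀ w, (∀ a, B w (v a) = 0) → B w w = 0 := fun w hw => by
      by_contra h
      obtain ⟨a, ha⟩ := hex w h
      exact ha (hw a)
    exfalso
    -- Polarization: if every vector of the orthogonal complement is isotropic, the form vanishes on
    -- it.
    have hpol : ∀ w w', (∀ a, B w (v a) = 0) → (∀ a, B w' (v a) = 0) → B w w' = 0 := by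
      intro w w' hw hw'
      by_contra hne
      obtain ⟨c, hc⟩ := hσ.exists_add_apply_ne_zero hne
      have h1 := hiso (c • w + w') fun a => by simp [hw a, hw' a]
      simp only [map_add, map_smul, LinearMap.add_apply, LinearMap.smul_apply, smul_eq_mul,
        LinearMap.map_smulₛₗ, hiso w hw, hiso w' hw', hB w w'] at h1
      refine hc ?_
      rw [map_mul]
      linear_combination h1
    have hproj : ∀ y b, B (y - ∑ a, B y (v a) • v a) (v b) = 0 := fun y b => by
      rw [map_sub, LinearMap.sub_apply, hv.apply_sum_left, sub_self]
    -- The projection of `y` to the complement is orthogonal to everything, hence zero; so `v` would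
    -- span.
    have hzero : ∀ y, y - ∑ a, B y (v a) • v a = 0 := fun y => by
      refine hnd _ fun z => ?_
      have hz : z = ∑ a, B z (v a) • v a + (z - ∑ a, B z (v a) • v a) := by abel
      rw [hz, map_add, hpol _ _ (hproj y) (hproj z), add_zero, map_sum]
      refine Finset.sum_eq_zero fun a _ => ?_
      rw [LinearMap.map_smulₛₗ, hproj, smul_zero]
    have hspan : Submodule.span K (Set.range v) = ⊤ := by
      rw [eq_top_iff]
      rintro y -
      rw [sub_eq_zero.1 (hzero y)]
      exact Submodule.sum_mem _ fun a _ =>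
        Submodule.smul_mem _ _ (Submodule.subset_span ⟨a, rfl⟩)
    have := finrank_range_le_card (R := K) (b := v)
    rw [Set.finrank, hspan, finrank_top] at this
    omega

theorem exists_extension (hσ : IsConjugation q σ) (hB : ∀ x y, B y x = σ (B x y))
    (hnd : ∀ x, (∀ y, B x y = 0) → x = 0) [FiniteDimensional K V] (hv : IsOrthonormalFamily B v)
    (m : ℕ) (hcard : Fintype.card ι + m ≤ Module.finrank K V) :
    ∃ w : Fin m → V, IsOrthonormalFamily B (Sum.elim v w) := by
  induction m with
  | zero =>
    refine ⟨Fin.elim0, ?_, ?_⟩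
    · rintro (a | a)
      · exact hv.apply_self a
      · exact a.elim0
    · rintro (a | a) (b | b) hab
      · exact hv.apply_of_ne a b (by simpa using hab)
      · exact b.elim0
      · exact a.elim0
      · exact a.elim0
  | succ m ih =>
    obtain ⟨w, hw⟩ := ih (by omega)
    obtain ⟨x, hx, hxv⟩ := exists_unit hσ hB hnd hw (by simp; omega)
    exact ⟨Fin.cons x w, hw.sumElim_cons hB hx hxv⟩

/-- The number of unit vectors orthogonal to an orthonormal family. -/
theorem natCard_unit (hσ : IsConjugation q σ) (hB : ∀ x y, B y x = σ (B x y))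
    (hnd : ∀ x, (∀ y, B x y = 0) → x = 0) [FiniteDimensional K V] (hv : IsOrthonormalFamily B v)
    {m : ℕ} (hcard : Fintype.card ι + m = Module.finrank K V) :
    Nat.card {x : V // B x x = 1 ∧ ∀ a, B x (v a) = 0} =
      Nat.card {c : Fin m → K // ∑ i, c i * σ (c i) = 1} := by
  obtain ⟨w, hw⟩ := exists_extension hσ hB hnd hv m hcard.le
  have hexp : ∀ x, (∀ a, B x (v a) = 0) → ∑ i, B x (w i) • w i = x := fun x hx => by
    conv_rhs => rw [← hw.sum_apply_smul (by simpa using hcard) x]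
    simp [hx]
  have hcoef : ∀ (c : Fin m → K) i, B (∑ i, c i • w i) (w i) = c i := fun c i => by
    have := hw.apply_sum_left (Sum.elim 0 c) (.inr i)
    simpa using this
  have hperp : ∀ (c : Fin m → K) a, B (∑ i, c i • w i) (v a) = 0 := fun c a => by
    have := hw.apply_sum_left (Sum.elim 0 c) (.inl a)
    simpa using this
  have hnorm : ∀ x (c : Fin m → K), B x (∑ i, c i • w i) = ∑ i, B x (w i) * σ (c i) := fun x c => by
    simp only [map_sum, LinearMap.map_smulₛₗ, smul_eq_mul, mul_comm]
  refine Nat.card_congr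
    { toFun := fun x => ⟨fun i => B x.1 (w i), ?_⟩
      invFun := fun c => ⟨∑ i, c.1 i • w i, ?_, hperp c.1⟩
      left_inv := fun x => Subtype.ext (hexp x.1 x.2.2)
      right_inv := fun c => Subtype.ext (funext fun i => hcoef c.1 i) }
  · rw [← hnorm, hexp x.1 x.2.2, x.2.1]
  · rw [hnorm]
    simp only [hcoef]
    exact c.2

theorem cons (hB : ∀ x y, B y x = σ (B x y)) {m : ℕ} {w : Fin m → V}
    (h : IsOrthonormalFamily B w) {x : V} (hx : B x x = 1) (hxw : ∀ a, B x (w a) = 0) :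
    IsOrthonormalFamily B (Fin.cons x w : Fin (m + 1) → V) := by
  refine ⟨fun a => Fin.cases hx h.apply_self a, fun a b => Fin.cases ?_ (fun i => ?_) a⟩
  · exact Fin.cases (fun h => absurd rfl h) (fun j _ => hxw j) b
  · refine Fin.cases (fun _ => ?_) (fun j hij => ?_) b
    · change B (w i) x = 0
      rw [hB x, hxw, map_zero]
    · exact h.apply_of_ne i j (by simpa using hij)

theorem natCard_succ (hσ : IsConjugation q σ) (hB : ∀ x y, B y x = σ (B x y))
    (hnd : ∀ x, (∀ y, B x y = 0) → x = 0) [FiniteDimensional K V] {j m : ℕ}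
    (hcard : j + m = Module.finrank K V) :
    Nat.card {v : Fin (j + 1) → V // IsOrthonormalFamily B v} =
      Nat.card {v : Fin j → V // IsOrthonormalFamily B v} *
        Nat.card {c : Fin m → K // ∑ i, c i * σ (c i) = 1} := by
  have := hσ.finite
  have : Finite V := Module.finite_of_finite K
  let := Fintype.ofFinite {v : Fin j → V // IsOrthonormalFamily B v}
  let e : {v : Fin (j + 1) → V // IsOrthonormalFamily B v} ≃
      Σ v : {v : Fin j → V // IsOrthonormalFamily B v},
        {x : V // B x x = 1 ∧ ∀ a, B x (v.1 a) = 0} :=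
    { toFun := fun v => ⟨⟨Fin.tail v.1, fun a => v.2.apply_self a.succ,
        fun a b hab => v.2.apply_of_ne _ _ (by simpa using hab)⟩, v.1 0, v.2.apply_self 0,
        fun a => v.2.apply_of_ne _ _ (Fin.succ_ne_zero a).symm⟩
      invFun := fun p => ⟨Fin.cons p.2.1 p.1.1, p.1.2.cons hB p.2.2.1 p.2.2.2⟩
      left_inv := fun v => Subtype.ext (Fin.cons_self_tail v.1)
      right_inv := fun p => rfl }
  rw [Nat.card_congr e, Nat.card_sigma, Finset.sum_congr rfl fun v _ =>
      natCard_unit hσ hB hnd v.2 (m := m) (by simpa using hcard), Finset.sum_const,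
      Finset.card_univ, smul_eq_mul, Nat.card_eq_fintype_card
        (α := {v : Fin j → V // IsOrthonormalFamily B v})]

theorem natCard_eq_prod (hσ : IsConjugation q σ) (hB : ∀ x y, B y x = σ (B x y))
    (hnd : ∀ x, (∀ y, B x y = 0) → x = 0) [FiniteDimensional K V] {n : ℕ}
    (hn : Module.finrank K V = n) :
    (Nat.card {v : Fin n → V // IsOrthonormalFamily B v} : ℤ) =
      ∏ i ∈ Finset.range n, (q ^ i * (q ^ (i + 1) - (-1) ^ (i + 1)) : ℤ) := by
  -- A family of size `j` leaves dimension `m = n - j` free, so its extensions contribute the first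
  -- `m` factors.
  have key : ∀ j m, j + m = n → (Nat.card {v : Fin j → V // IsOrthonormalFamily B v} : ℤ) *
      ∏ i ∈ Finset.range m, (q ^ i * (q ^ (i + 1) - (-1) ^ (i + 1)) : ℤ) =
      ∏ i ∈ Finset.range n, (q ^ i * (q ^ (i + 1) - (-1) ^ (i + 1)) : ℤ) := by
    intro j
    induction j with
    | zero =>
      intro m hm
      have : Nat.card {v : Fin 0 → V // IsOrthonormalFamily B v} = 1 := by
        rw [Nat.card_eq_one_iff_unique]
        exact ⟨inferInstance, ⟨Fin.elim0, fun a => a.elim0, fun a => a.elim0⟩⟩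
      rw [this, Nat.cast_one, one_mul, ← hm, zero_add]
    | succ j ih =>
      intro m hm
      rw [← ih (m + 1) (by omega), natCard_succ hσ hB hnd (m := m + 1) (by omega), Nat.cast_mul,
        hσ.natCard_sum_norm_eq_one, Finset.prod_range_succ]
      ring
  simpa using key n 0 rfl

end IsOrthonormalFamily

end HermitianForms

/-! ### Hermitian matrices and the order of the unitary group. -/

section HermitianMatrices

variable {K : Type*} [Field K] {q : ℕ} {σ : K →+* K} {ι : Type*} [Fintype ι]

/-- The sesquilinear form `x, y ↦ xᵀ β σ(y)`. -/
def hermitianForm (σ : K →+* K) (β : Matrix ι ι K) : (ι → K) →ₗ[K] (ι → K) →ₛₗ[σ] K :=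
  LinearMap.mk₂'ₛₗ (RingHom.id K) σ (fun x y => x ⬝ᵥ β *ᵥ (σ ∘ y))
    (fun x y z => add_dotProduct x y _) (fun c x y => smul_dotProduct c x _)
    (fun x y z => by
      rw [← dotProduct_add, ← Matrix.mulVec_add]
      congr 2
      ext i
      simp)
    (fun c x y => by
      rw [← dotProduct_smul, ← Matrix.mulVec_smul]
      congr 2
      ext i
      simp)

theorem hermitianForm_apply (β : Matrix ι ι K) (x y : ι → K) :
    hermitianForm σ β x y = x ⬝ᵥ β *ᵥ (σ ∘ y) := rfl

theorem transpose_mul_mul_map_apply {κ : Type*} (β : Matrix ι ι K) (A : Matrix ι κ K) (i j : κ) :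
    (Aᵀ * β * A.map σ) i j = hermitianForm σ β (Aᵀ i) (Aᵀ j) := by
  rw [hermitianForm_apply, Matrix.dotProduct_mulVec]
  rfl

theorem hermitianForm_symm (hσ : IsConjugation q σ) {β : Matrix ι ι K} (hβ : βᵀ = β.map σ)
    (x y : ι → K) : hermitianForm σ β y x = σ (hermitianForm σ β x y) := by
  have hyy : (fun i => σ ((σ ∘ y) i)) = y := funext fun i => hσ.apply_apply _
  rw [hermitianForm_apply, hermitianForm_apply, RingHom.map_dotProduct, dotProduct_comm (_ ∘ x)]
  have : (σ ∘ (β *ᵥ (σ ∘ y))) = βᵀ *ᵥ y := by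
    rw [hβ]
    conv_rhs => rw [← hyy]
    exact funext fun i => RingHom.map_mulVec σ β _ i
  rw [this, Matrix.mulVec_transpose, Matrix.dotProduct_mulVec]

variable [DecidableEq ι]

theorem eq_zero_of_hermitianForm_eq_zero {β : Matrix ι ι K} (hdet : β.det ≠ 0) (x : ι → K)
    (h : ∀ y, hermitianForm σ β x y = 0) : x = 0 := by
  have h0 : x ᵥ* β = 0 := funext fun i => by
    have := h (Pi.single i 1)
    rw [hermitianForm_apply, Matrix.dotProduct_mulVec] at this
    have hs : (σ ∘ Pi.single i 1 : ι → K) = Pi.single i 1 := by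
      ext j
      by_cases hij : j = i
      · subst hij; simp
      · simp [hij]
    rw [hs] at this
    simpa using this
  exact Matrix.eq_zero_of_vecMul_eq_zero hdet h0

theorem isOrthonormalFamily_iff (β A : Matrix ι ι K) :
    IsOrthonormalFamily (hermitianForm σ β) (fun i => Aᵀ i) ↔ Aᵀ * β * A.map σ = 1 := by
  rw [← Matrix.ext_iff]
  simp only [transpose_mul_mul_map_apply]
  constructor
  · intro h i j
    by_cases hij : i = j
    · subst hij; rw [h.apply_self, Matrix.one_apply_eq]
    · rw [h.apply_of_ne _ _ hij, Matrix.one_apply_ne hij]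
  · intro h
    exact ⟨fun a => by rw [h, Matrix.one_apply_eq], fun a b hab => by rw [h, Matrix.one_apply_ne hab]⟩

/-- Every Hermitian form over a finite field has an orthonormal basis. -/
theorem exists_transpose_mul_mul_map_eq_one (hσ : IsConjugation q σ) {β : Matrix ι ι K}
    (hβ : βᵀ = β.map σ) (hdet : β.det ≠ 0) : ∃ P : Matrix ι ι K, Pᵀ * β * P.map σ = 1 := by
  have h0 : IsOrthonormalFamily (hermitianForm σ β) (Fin.elim0 : Fin 0 → ι → K) :=
    ⟨fun a => a.elim0, fun a => a.elim0⟩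
  obtain ⟨w, hw⟩ := h0.exists_extension hσ (hermitianForm_symm hσ hβ)
    (eq_zero_of_hermitianForm_eq_zero hdet) (Fintype.card ι) (by simp)
  let e := Fintype.equivFin ι
  refine ⟨(Matrix.of fun i => w (e i))ᵀ, (isOrthonormalFamily_iff β _).1 ⟨fun a => ?_,
    fun a b hab => ?_⟩⟩
  · exact hw.apply_self (.inr (e a))
  · exact hw.apply_of_ne (.inr (e a)) (.inr (e b)) (by simpa using hab)

theorem det_ne_zero_of_transpose_mul_mul_map_eq_one {β P : Matrix ι ι K}
    (h : Pᵀ * β * P.map σ = 1) : P.det ≠ 0 := by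
  intro h0
  have := congrArg Matrix.det h
  rw [Matrix.det_mul, Matrix.det_mul, Matrix.det_transpose, h0] at this
  simp at this

/-- The unitary group acts simply transitively on orthonormal bases; with a base point `P`, the
matrix `M` corresponds to the columns of `M * P`. -/
theorem natCard_hermitianUnitaryGroup (hσ : IsConjugation q σ) {n : ℕ}
    {β : Matrix (Fin n) (Fin n) K} (hβ : βᵀ = β.map σ) (hdet : β.det ≠ 0) :
    (Nat.card (hermitianUnitaryGroup σ β) : ℤ) =
      ∏ i ∈ Finset.range n, (q ^ i * (q ^ (i + 1) - (-1) ^ (i + 1)) : ℤ) := by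
  rw [← IsOrthonormalFamily.natCard_eq_prod hσ (hermitianForm_symm hσ hβ)
    (eq_zero_of_hermitianForm_eq_zero hdet) (by simp)]
  obtain ⟨P, hP⟩ := exists_transpose_mul_mul_map_eq_one hσ hβ hdet
  have hPdet := (det_ne_zero_of_transpose_mul_mul_map_eq_one hP).isUnit
  have hPinv : P * P⁻¹ = 1 := Matrix.mul_nonsing_inv P hPdet
  have hPinv' : P⁻¹ * P = 1 := Matrix.nonsing_inv_mul P hPdet
  have hβP : β = (P⁻¹)ᵀ * P⁻¹.map σ := by
    have h1 : (P⁻¹)ᵀ * Pᵀ = 1 := by rw [← Matrix.transpose_mul, hPinv, Matrix.transpose_one]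
    have h2 : P.map σ * P⁻¹.map σ = 1 := by
      rw [← Matrix.map_mul, hPinv, Matrix.map_one _ (map_zero σ) (map_one σ)]
    calc β = ((P⁻¹)ᵀ * Pᵀ) * β * (P.map σ * P⁻¹.map σ) := by rw [h1, h2, one_mul, mul_one]
      _ = (P⁻¹)ᵀ * (Pᵀ * β * P.map σ) * P⁻¹.map σ := by simp only [Matrix.mul_assoc]
      _ = _ := by rw [hP, mul_one]
  congr 1
  have key : ∀ M : Matrix (Fin n) (Fin n) K,
      (M * P)ᵀ * β * (M * P).map σ = Pᵀ * (Mᵀ * β * M.map σ) * P.map σ := fun M => by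
    rw [Matrix.transpose_mul, Matrix.map_mul]
    simp only [Matrix.mul_assoc]
  have key' : ∀ A : Matrix (Fin n) (Fin n) K,
      (A * P⁻¹)ᵀ * β * (A * P⁻¹).map σ = (P⁻¹)ᵀ * (Aᵀ * β * A.map σ) * P⁻¹.map σ := fun M => by
    rw [Matrix.transpose_mul, Matrix.map_mul]
    simp only [Matrix.mul_assoc]
  refine Nat.card_congr
    { toFun := fun M => ⟨fun i => (M.1.1 * P)ᵀ i, (isOrthonormalFamily_iff β _).2 ?_⟩
      invFun := fun v => ⟨Matrix.GeneralLinearGroup.mkOfDetNeZero ((Matrix.of v.1)ᵀ * P⁻¹) ?_, ?_⟩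
      left_inv := fun M => ?_
      right_inv := fun v => ?_ }
  · have hM : M.1.1ᵀ * β * M.1.1.map σ = β := M.2
    rw [key, hM, hP]
  · rw [Matrix.det_mul]
    refine mul_ne_zero (det_ne_zero_of_transpose_mul_mul_map_eq_one
      ((isOrthonormalFamily_iff β _).1 v.2)) ?_
    exact (Matrix.isUnit_nonsing_inv_det P hPdet).ne_zero
  · change ((Matrix.of v.1)ᵀ * P⁻¹)ᵀ * β * ((Matrix.of v.1)ᵀ * P⁻¹).map σ = β
    rw [key', (isOrthonormalFamily_iff β (Matrix.of v.1)ᵀ).1 v.2, mul_one, ← hβP]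
  · refine Subtype.ext (Units.ext ?_)
    change M.1.1 * P * P⁻¹ = M.1.1
    rw [Matrix.mul_assoc, hPinv, mul_one]
  · refine Subtype.ext ?_
    change ((Matrix.of v.1)ᵀ * P⁻¹ * P)ᵀ = v.1
    rw [Matrix.mul_assoc, hPinv', mul_one]
    rfl

/-! ### The general linear group inside a unitary group -/

/-- Two Hermitian forms of the same rank are isometric. -/
theorem exists_transpose_mul_mul_map_eq (hσ : IsConjugation q σ) {β β' : Matrix ι ι K}
    (hβ : βᵀ = β.map σ) (hdet : β.det ≠ 0) (hβ' : β'ᵀ = β'.map σ) (hdet' : β'.det ≠ 0) :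
    ∃ Q : GL ι K, Q.1ᵀ * β * Q.1.map σ = β' := by
  obtain ⟨P, hP⟩ := exists_transpose_mul_mul_map_eq_one hσ hβ hdet
  obtain ⟨P', hP'⟩ := exists_transpose_mul_mul_map_eq_one hσ hβ' hdet'
  let p := Matrix.GeneralLinearGroup.mkOfDetNeZero P
    (det_ne_zero_of_transpose_mul_mul_map_eq_one hP)
  let p' := Matrix.GeneralLinearGroup.mkOfDetNeZero P'
    (det_ne_zero_of_transpose_mul_mul_map_eq_one hP')
  have h1 : p'⁻¹.1ᵀ * P'ᵀ = 1 := by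
    rw [← Matrix.transpose_mul]
    change (p' * p'⁻¹).1ᵀ = 1
    rw [mul_inv_cancel, Units.val_one, Matrix.transpose_one]
  have h2 : P'.map σ * p'⁻¹.1.map σ = 1 := by
    rw [← Matrix.map_mul]
    change (p' * p'⁻¹).1.map σ = 1
    rw [mul_inv_cancel, Units.val_one, Matrix.map_one _ (map_zero σ) (map_one σ)]
  refine ⟨p * p'⁻¹, ?_⟩
  calc (p * p'⁻¹).1ᵀ * β * (p * p'⁻¹).1.map σ
      = p'⁻¹.1ᵀ * (Pᵀ * β * P.map σ) * p'⁻¹.1.map σ := by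
        rw [Units.val_mul, Matrix.transpose_mul, Matrix.map_mul]
        simp only [Matrix.mul_assoc]
        rfl
    _ = p'⁻¹.1ᵀ * (P'ᵀ * β' * P'.map σ) * p'⁻¹.1.map σ := by rw [hP, hP']
    _ = (p'⁻¹.1ᵀ * P'ᵀ) * β' * (P'.map σ * p'⁻¹.1.map σ) := by simp only [Matrix.mul_assoc]
    _ = β' := by rw [h1, h2, one_mul, mul_one]

/-- The orthogonal sum of a hyperbolic form and a standard form. -/
def hyperbolicMatrix (K κ κ' : Type*) [Field K] [DecidableEq κ] [DecidableEq κ'] :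
    Matrix ((κ ⊕ κ) ⊕ κ') ((κ ⊕ κ) ⊕ κ') K :=
  Matrix.fromBlocks (Matrix.fromBlocks 0 1 1 0) 0 0 1

variable {κ κ' : Type*} [DecidableEq κ] [DecidableEq κ']

theorem transpose_hyperbolicMatrix (σ : K →+* K) :
    (hyperbolicMatrix K κ κ')ᵀ = (hyperbolicMatrix K κ κ').map σ := by
  simp [hyperbolicMatrix, Matrix.fromBlocks_transpose, Matrix.fromBlocks_map]

variable [Fintype κ] [Fintype κ']

theorem det_hyperbolicMatrix_ne_zero : (hyperbolicMatrix K κ κ').det ≠ 0 := by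
  have h : hyperbolicMatrix K κ κ' * hyperbolicMatrix K κ κ' = 1 := by
    simp [hyperbolicMatrix, Matrix.fromBlocks_multiply]
  exact (Matrix.isUnit_det_of_left_inverse h).ne_zero

/-- The action of `A` on a Lagrangian, extended to an isometry of the hyperbolic form. -/
def leviHom (σ : K →+* K) (κ κ' : Type*) [Fintype κ] [DecidableEq κ] [Fintype κ'] [DecidableEq κ'] :
    GL κ K →* Matrix ((κ ⊕ κ) ⊕ κ') ((κ ⊕ κ) ⊕ κ') K where
  toFun A := Matrix.fromBlocks (Matrix.fromBlocks A.1 0 0 (A⁻¹.1ᵀ.map σ)) 0 0 1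
  map_one' := by simp [-Matrix.coe_units_inv]
  map_mul' A B := by
    simp [-Matrix.coe_units_inv, Matrix.fromBlocks_multiply, Matrix.transpose_mul, Matrix.map_mul]

/-- The two Lagrangians are paired by the form, so the conjugate inverse transpose on the second
undoes `A` on the first; this uses that `σ` is an involution. -/
theorem leviHom_isometry (hσ : IsConjugation q σ) (A : GL κ K) :
    (leviHom σ κ κ' A)ᵀ * hyperbolicMatrix K κ κ' * (leviHom σ κ κ' A).map σ =
      hyperbolicMatrix K κ κ' := by
  have h1 : A.1ᵀ * A⁻¹.1ᵀ = 1 := by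
    rw [← Matrix.transpose_mul, ← Units.val_mul, inv_mul_cancel, Units.val_one,
      Matrix.transpose_one]
  have h2 : A⁻¹.1.map σ * A.1.map σ = 1 := by
    rw [← Matrix.map_mul, ← Units.val_mul, inv_mul_cancel, Units.val_one,
      Matrix.map_one _ (map_zero σ) (map_one σ)]
  have h3 : (A⁻¹.1ᵀ.map σ).map σ = A⁻¹.1ᵀ := by
    ext i j
    simp [-Matrix.coe_units_inv, hσ.apply_apply]
  have h4 : (A⁻¹.1ᵀ.map σ)ᵀ = A⁻¹.1.map σ := by
    rw [Matrix.transpose_map, Matrix.transpose_transpose]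
  simp only [leviHom, hyperbolicMatrix, MonoidHom.coe_mk, OneHom.coe_mk,
    Matrix.fromBlocks_transpose, Matrix.fromBlocks_map, Matrix.fromBlocks_multiply, h3, h4]
  simp [-Matrix.coe_units_inv, Matrix.fromBlocks_multiply, h1, h2]

theorem leviHom_injective (σ : K →+* K) : Function.Injective (leviHom σ κ κ') := by
  intro A B h
  have h' := congrArg (fun M => M.toBlocks₁₁.toBlocks₁₁) h
  exact Units.ext (by simpa [leviHom] using h')

/-- `GL_m` embeds into every unitary group in at least `2 m` variables. -/
theorem exists_injective_unitary (hσ : IsConjugation q σ) {m n : ℕ} (hmn : 2 * m ≤ n)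
    {β : Matrix (Fin n) (Fin n) K} (hβ : βᵀ = β.map σ) (hdet : β.det ≠ 0) :
    ∃ φ : GL (Fin m) K →* hermitianUnitaryGroup σ β, Function.Injective φ := by
  let e : (Fin m ⊕ Fin m) ⊕ Fin (n - 2 * m) ≃ Fin n :=
    Fintype.equivFinOfCardEq (by simp; omega)
  let η := (hyperbolicMatrix K (Fin m) (Fin (n - 2 * m))).submatrix e.symm e.symm
  have hη : ηᵀ = η.map σ := by
    rw [Matrix.transpose_submatrix, transpose_hyperbolicMatrix σ]
    rfl
  have hηdet : η.det ≠ 0 := by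
    rw [Matrix.det_submatrix_equiv_self]
    exact det_hyperbolicMatrix_ne_zero
  -- `Q` carries the model form `η` to `β`, so conjugating by `Q⁻¹` turns isometries of `η` into
  -- isometries of `β`.
  obtain ⟨Q, hQ⟩ := exists_transpose_mul_mul_map_eq hσ hη hηdet hβ hdet
  let D : GL (Fin m) K →* Matrix (Fin n) (Fin n) K :=
    ((Matrix.reindexAlgEquiv K K e).toAlgHom : _ →* _).comp (leviHom σ (Fin m) (Fin (n - 2 * m)))
  have hD : ∀ A, (D A)ᵀ * η * (D A).map σ = η := fun A => by
    have := congrArg (fun M => M.submatrix e.symm e.symm)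
      (leviHom_isometry (κ' := Fin (n - 2 * m)) hσ A)
    simp only [← Matrix.submatrix_mul_equiv _ _ e.symm e.symm] at this
    exact this
  let φ : GL (Fin m) K →* GL (Fin n) K :=
    (MulAut.conj Q⁻¹).toMonoidHom.comp D.toHomUnits
  have hφ : ∀ A, φ A ∈ hermitianUnitaryGroup σ β := fun A => by
    have hconj : Q.1 * (φ A).1 = D A * Q.1 := by
      change (Q * (Q⁻¹ * D.toHomUnits A * Q⁻¹⁻¹)).1 = (D.toHomUnits A * Q).1
      rw [inv_inv, mul_assoc, mul_inv_cancel_left]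
    change (φ A).1ᵀ * β * (φ A).1.map σ = β
    calc (φ A).1ᵀ * β * (φ A).1.map σ
        = (Q.1 * (φ A).1)ᵀ * η * (Q.1 * (φ A).1).map σ := by
          rw [← hQ, Matrix.transpose_mul, Matrix.map_mul]
          simp only [Matrix.mul_assoc]
      _ = Q.1ᵀ * ((D A)ᵀ * η * (D A).map σ) * Q.1.map σ := by
          rw [hconj, Matrix.transpose_mul, Matrix.map_mul]
          simp only [Matrix.mul_assoc]
      _ = β := by rw [hD, hQ]
  refine ⟨φ.codRestrict _ hφ, ?_⟩
  rw [MonoidHom.injective_codRestrict]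
  refine (MulAut.conj Q⁻¹).injective.comp fun A B h => ?_
  have h' : D A = D B := congrArg Units.val h
  exact leviHom_injective σ ((Matrix.reindexAlgEquiv K K e).injective h')

end HermitianMatrices

/-! ### Group orders and divisibility by `l`. -/

section Orders

theorem isConjugation_conjFq (p r : ℕ) [Fact p.Prime] (hr : 0 < r) :
    IsConjugation (p ^ r) (conjFq p r) where
  card_eq := by rw [GaloisField.card p (2 * r) (by omega), ← pow_mul, mul_comm]
  one_lt := Nat.one_lt_pow hr.ne' (Fact.out : p.Prime).one_lt
  apply_eq a := iterateFrobenius_def p r a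

theorem natCard_generalLinearGroup {K : Type*} [Field K] {q : ℕ} (hK : Nat.card K = q ^ 2)
    (hq : 0 < q) (n : ℕ) : (Nat.card (GL (Fin n) K) : ℤ) =
      ∏ i ∈ Finset.range n, (q ^ (2 * i) * (q ^ (2 * (i + 1)) - 1) : ℤ) := by
  have : Finite K := Nat.finite_of_card_ne_zero (by rw [hK]; positivity)
  have := Fintype.ofFinite K
  rw [Matrix.card_GL_field, ← Nat.card_eq_fintype_card, hK, Nat.cast_prod,
    Finset.prod_range fun i => (q ^ (2 * i) * (q ^ (2 * (i + 1)) - 1) : ℤ)]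
  rw [Finset.prod_mul_distrib]
  -- Reversing only these factors matches `q^(2n) - q^(2i) = q^(2i) (q^(2(n-i)) - 1)`.
  rw [← Equiv.prod_comp Fin.revPerm fun i : Fin n => ((q : ℤ) ^ (2 * ((i : ℕ) + 1)) - 1),
    ← Finset.prod_mul_distrib]
  refine Finset.prod_congr rfl fun i _ => ?_
  have hi := i.2
  rw [Nat.cast_sub (Nat.pow_le_pow_right (by positivity) hi.le), mul_sub, mul_one, ← pow_add,
    Fin.revPerm_apply, Fin.val_rev]
  push_cast
  rw [← pow_mul, ← pow_mul]
  congr 2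
  omega

theorem not_dvd_index_of_natCard_eq_mul {G H : Type*} [Group G] [Finite G] [Group H] {φ : H →* G}
    (hφ : Function.Injective φ) {l : ℕ} {c : ℤ} (hc : (Nat.card G : ℤ) = Nat.card H * c)
    (hl : ¬ (l : ℤ) ∣ c) : ¬ l ∣ φ.range.index := by
  have := Finite.of_injective φ hφ
  have h1 : Nat.card φ.range = Nat.card H := (Nat.card_congr (MonoidHom.ofInjective hφ).toEquiv).symm
  have h2 := φ.range.card_mul_index
  rw [h1] at h2
  rw [← h2, Nat.cast_mul] at hc
  have h3 : (φ.range.index : ℤ) = c :=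
    mul_left_cancel₀ (Nat.cast_ne_zero.2 Nat.card_pos.ne') hc
  rwa [← h3, Int.natCast_dvd_natCast] at hl

variable {q l d : ℕ}

/-- `d` is the order of `q` in `ZMod l`. -/
theorem dvd_pow_sub_one_iff (hq : 0 < q) (hd : IsLeast {m : ℕ | 0 < m ∧ l ∣ q ^ m - 1} d)
    (m : ℕ) : (l : ℤ) ∣ (q : ℤ) ^ m - 1 ↔ d ∣ m := by
  have hcast : ∀ m, l ∣ q ^ m - 1 ↔ (q : ZMod l) ^ m = 1 := fun m => by
    rw [← ZMod.natCast_eq_zero_iff, Nat.cast_sub (Nat.one_le_pow _ _ hq), sub_eq_zero]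
    push_cast
    rfl
  have hord : orderOf (q : ZMod l) = d := by
    rw [orderOf_eq_iff hd.1.1]
    refine ⟨(hcast d).1 hd.1.2, fun m hm hm0 h => ?_⟩
    exact absurd (hd.2 ⟨hm0, (hcast m).2 h⟩) (not_le.2 hm)
  rw [← hord, orderOf_dvd_iff_pow_eq_one, ← ZMod.intCast_zmod_eq_zero_iff_dvd, Int.cast_sub,
    sub_eq_zero]
  push_cast
  rfl

theorem dvd_pow_two_mul_sub_one {i : ℕ} (h : (l : ℤ) ∣ (q : ℤ) ^ i + 1) :
    (l : ℤ) ∣ (q : ℤ) ^ (2 * i) - 1 := by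
  have : (q : ℤ) ^ (2 * i) - 1 = (q ^ i + 1) * (q ^ i - 1) := by ring
  rw [this]
  exact h.mul_right _

theorem not_dvd_pow_sub_one_of_dvd_pow_add_one (hl : l.Prime) (hl2 : l ≠ 2) {i : ℕ}
    (h : (l : ℤ) ∣ (q : ℤ) ^ i + 1) : ¬ (l : ℤ) ∣ (q : ℤ) ^ i - 1 := fun h' => by
  have h2 : (l : ℤ) ∣ ((2 : ℕ) : ℤ) := by
    have := dvd_sub h h'
    ring_nf at this
    exact_mod_cast this
  exact hl2 ((Nat.prime_dvd_prime_iff_eq hl Nat.prime_two).1 (Int.natCast_dvd_natCast.1 h2))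

/-- For odd `i`, the even number `d` would divide `i`. For even `i`, `d ∣ 2 * i` and `d / 2` odd
give `d ∣ i`, so `l` would divide both `q^i + 1` and `q^i - 1`. -/
theorem not_dvd_pow_add_neg_one_pow (hq : 0 < q) (hl : l.Prime) (hl2 : l ≠ 2)
    (hd : IsLeast {m : ℕ | 0 < m ∧ l ∣ q ^ m - 1} d) (hd4 : d % 4 = 2) (i : ℕ) :
    ¬ (l : ℤ) ∣ (q : ℤ) ^ i + (-1) ^ i := by
  intro h
  rcases Nat.even_or_odd i with hi | hi
  · rw [hi.neg_one_pow] at h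
    have h1 := (dvd_pow_sub_one_iff hq hd _).1 (dvd_pow_two_mul_sub_one h)
    refine not_dvd_pow_sub_one_of_dvd_pow_add_one hl hl2 h ((dvd_pow_sub_one_iff hq hd _).2 ?_)
    obtain ⟨b, rfl⟩ := hi.two_dvd
    obtain ⟨e, rfl⟩ : 2 ∣ d := by omega
    have he : Nat.Coprime e 2 := (Nat.coprime_two_right.2 (Nat.odd_iff.2 (by omega)))
    exact Nat.mul_dvd_mul_left 2
      (he.dvd_of_dvd_mul_left (Nat.dvd_of_mul_dvd_mul_left two_pos h1))
  · rw [hi.neg_one_pow, ← sub_eq_add_neg, dvd_pow_sub_one_iff hq hd] at h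
    have := (show 2 ∣ d by omega).trans h
    rw [Nat.odd_iff] at hi
    omega

/-- Here `d ∣ 2 * i` with `i` odd. If `d` is even this forces `d ≡ 2 mod 4`; if `d` is odd then `d ∣
i`, so `l` would divide `q^i - 1` as well. -/
theorem not_dvd_pow_add_one (hq : 0 < q) (hl : l.Prime) (hl2 : l ≠ 2)
    (hd : IsLeast {m : ℕ | 0 < m ∧ l ∣ q ^ m - 1} d) (hd4 : d % 4 ≠ 2) {i : ℕ} (hi : Odd i) :
    ¬ (l : ℤ) ∣ (q : ℤ) ^ i + 1 := by
  intro h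
  have h1 := (dvd_pow_sub_one_iff hq hd _).1 (dvd_pow_two_mul_sub_one h)
  rcases Nat.even_or_odd d with hde | hdo
  · obtain ⟨e, rfl⟩ := hde.two_dvd
    have he : Odd e := hi.of_dvd_nat (Nat.dvd_of_mul_dvd_mul_left two_pos h1)
    rw [Nat.odd_iff] at he
    omega
  · exact not_dvd_pow_sub_one_of_dvd_pow_add_one hl hl2 h ((dvd_pow_sub_one_iff hq hd _).2
      ((Nat.coprime_two_right.2 hdo).dvd_of_dvd_mul_left h1))

/-- Factors with even `i + 1` give the order of `GL_m` over the field of `q²` elements, the others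
the index; the powers of `q` are swapped within each pair. -/
theorem prod_unitary_even (q : ℤ) (m : ℕ) :
    ∏ i ∈ Finset.range (2 * m), (q ^ i * (q ^ (i + 1) - (-1) ^ (i + 1))) =
      (∏ i ∈ Finset.range m, (q ^ (2 * i) * (q ^ (2 * (i + 1)) - 1))) *
        ∏ i ∈ Finset.range m, (q ^ (2 * i + 1) * (q ^ (2 * i + 1) + 1)) := by
  induction m with
  | zero => simp
  | succ m ih =>
    have hs : ((-1 : ℤ)) ^ (2 * m) = 1 := by rw [pow_mul]; simp
    rw [show 2 * (m + 1) = 2 * m + 1 + 1 by ring, Finset.prod_range_succ, Finset.prod_range_succ,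
      ih, Finset.prod_range_succ, Finset.prod_range_succ]
    simp only [pow_succ (-1 : ℤ), hs]
    ring

end Orders

/-! ### The main theorem. -/

theorem theorem9 (p r n l d : ℕ) [Fact p.Prime] (hr : 0 < r) (hl : l.Prime)
    (hl2 : l ≠ 2) (hlp : l ≠ p)
    (k : Type*) [Field k] (hk : ringChar k ≠ l)
    (hd : IsLeast {m : ℕ | 0 < m ∧ l ∣ (p ^ r) ^ m - 1} d)
    (β : Matrix (Fin n) (Fin n) (GaloisField p (2 * r)))
    (hβ : βᵀ = β.map (conjFq p r)) (hβdet : β.det ≠ 0) :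
    (d % 4 = 2 →
      essDim k (UnitaryFq p r n β) l = essDim k (GL (Fin n) (GaloisField p (2 * r))) l) ∧
    (d % 4 ≠ 2 →
      essDim k (UnitaryFq p r n β) l =
        essDim k (GL (Fin (n / 2)) (GaloisField p (2 * r))) l) := by
  have hσ := isConjugation_conjFq p r hr
  have hq : 0 < p ^ r := by have := hσ.one_lt; omega
  have := hσ.finite
  have hU := natCard_hermitianUnitaryGroup hσ hβ hβdet
  have hlZ : Prime (l : ℤ) := Nat.prime_iff_prime_int.1 hl
  have hlq : ∀ i, ¬ (l : ℤ) ∣ ((p ^ r : ℕ) : ℤ) ^ i := fun i h => by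
    have h1 := Int.natCast_dvd_natCast.1 (hlZ.dvd_of_dvd_pow h)
    exact hlp ((Nat.prime_dvd_prime_iff_eq hl Fact.out).1 (hl.dvd_of_dvd_pow h1))
  constructor
  · intro hd4
    refine essDim_eq_of_not_dvd_index (φ := (UnitaryFq p r n β).subtype)
      (Subgroup.subtype_injective _) k hl (not_dvd_index_of_natCard_eq_mul
        (Subgroup.subtype_injective _)
        (c := ∏ i ∈ Finset.range n, (((p ^ r : ℕ) : ℤ) ^ i *
          (((p ^ r : ℕ) : ℤ) ^ (i + 1) + (-1) ^ (i + 1)))) ?_ ?_)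
    · rw [hU, natCard_generalLinearGroup hσ.card_eq hq, ← Finset.prod_mul_distrib]
      refine Finset.prod_congr rfl fun i _ => ?_
      -- Factorwise, `q^(2j) - 1 = (q^j - s) (q^j + s)` with `s = (-1)^j` and `j = i + 1`.
      have hs : ((-1 : ℤ) ^ (i + 1)) ^ 2 = 1 := by rw [← pow_mul, mul_comm, pow_mul]; simp
      rw [two_mul i, pow_add, mul_comm 2, pow_mul]
      linear_combination (((p ^ r : ℕ) : ℤ) ^ i * ((p ^ r : ℕ) : ℤ) ^ i) * hs
    · rw [hlZ.dvd_finsetProd_iff]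
      rintro ⟨i, -, hi⟩
      rcases hlZ.dvd_or_dvd hi with h | h
      · exact hlq i h
      · exact not_dvd_pow_add_neg_one_pow hq hl hl2 hd hd4 (i + 1) h
  · intro hd4
    obtain ⟨φ, hφ⟩ := exists_injective_unitary hσ (m := n / 2) (by omega) hβ hβdet
    have hodd : ∀ i j, ¬ (l : ℤ) ∣ ((p ^ r : ℕ) : ℤ) ^ j *
        (((p ^ r : ℕ) : ℤ) ^ (2 * i + 1) + 1) := fun i j h => by
      rcases hlZ.dvd_or_dvd h with h | h
      · exact hlq j h
      · exact not_dvd_pow_add_one hq hl hl2 hd hd4 (odd_two_mul_add_one i) h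
    have hprod : ¬ (l : ℤ) ∣ ∏ i ∈ Finset.range (n / 2), (((p ^ r : ℕ) : ℤ) ^ (2 * i + 1) *
        (((p ^ r : ℕ) : ℤ) ^ (2 * i + 1) + 1)) := by
      rw [hlZ.dvd_finsetProd_iff]
      rintro ⟨i, -, hi⟩
      exact hodd _ _ hi
    symm
    refine essDim_eq_of_not_dvd_index hφ k hl ?_
    rcases Nat.even_or_odd' n with ⟨m, rfl | rfl⟩
    · rw [Nat.mul_div_cancel_left m two_pos] at hprod
      refine not_dvd_index_of_natCard_eq_mul hφ ?_ hprod
      rw [hU, prod_unitary_even, natCard_generalLinearGroup hσ.card_eq hq,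
        Nat.mul_div_cancel_left m two_pos]
    -- Odd `n` adds the factor `q^(2m) (q^(2m+1) + 1)` to the index, again with an odd exponent.
    · have hm : (2 * m + 1) / 2 = m := by omega
      rw [hm] at hprod
      refine not_dvd_index_of_natCard_eq_mul hφ (c := _ * _) ?_
        fun h => (hlZ.dvd_or_dvd h).elim hprod (hodd m (2 * m))
      rw [hU, Finset.prod_range_succ, prod_unitary_even,
        natCard_generalLinearGroup hσ.card_eq hq, hm, (odd_two_mul_add_one m).neg_one_pow,
        sub_neg_eq_add, mul_assoc]
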